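/- **Setting.** For $m,k\ge 0$ and a real $m\times k$ matrix $A$ let $\|A\|_{\max}=\max_{i,j}|A_{ij}|$ and $\|A\|_{2,\infty}=\max_i\|A_{i,:}\|_2$. Let $W_0$ be the principal branch of the Lambert function, $\rho_0=\sqrt{1+e^{W_0(2/e^2)+2}}\approx 3.19$ and $\kappa=2\rho_0+1$. For queries, keys and values $Q,K,V\in\mathbb R^{n\times d}$ with rows $q_i,k_l,v_l$ and a scale $\beta>0$, the softmax matrix $O$ has the rows $o_i=\sum_l e^{\beta\langle q_i,k_l\rangle}v_l\big/\sum_l e^{\beta\langle q_i,k_l\rangle}$. Let $\bar k=\frac1n\sum_l k_l$, $\tilde k_l=k_l-\bar k$, $R_Q=\|Q\|_{2,\infty}$ and $R_K=\max_l\|\tilde k_l\|_2$ (the row norm of the recentred keys). **The algorithm.** WildCat with rank $r$ (and one bin) computes the temperature $\tau=\sqrt{\frac{R_K}{R_Q}\cdot\frac{b_0}{2W_0(b_0/(2\rho_0))}}$, where $b_0=\frac{\log n}{\beta R_QR_K}+2$, and uses the kernel $h_\tau(x,y)=\exp(\beta\langle x,y\rangle/\tau^2)$ (with $h_\tau\equiv1$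 if $R_QR_K=0$). It starts with $p_l=h_\tau(\tilde k_l,\tilde k_l)$, an $r\times r$ matrix $M=0$ and an $r\times n$ matrix $R^{\rm ker}=0$. In round $i=1,\dots,r$ (stopping early if $p=0$; the rounds not performed then contribute nothing below, their rows of $M$ and $R^{\rm ker}$ being zero) it draws $s_i\in\{1,\dots,n\}$ with probabilities $p_l/\sum_{l'}p_{l'}$; sets $g_{[i-1]}=M_{[i-1],[i-1]}R^{\rm ker}_{[i-1],s_i}/\sqrt{p_{s_i}}$, $g_i=-1/\sqrt{p_{s_i}}$ and $g_j=0$ for $j>i$; replaces $M$ by $M+gg^\top$; sets the $i$-th row of $R^{\rm ker}$ to $(h_\tau(\tilde k_{s_i},\tilde k_l))_l$; and replaces $p_l$ by $p_l-(g^\top R^{\rm ker})_l^2$ and $p_{s_i}$ by $0$. With the weights $W=MR^{\rm ker}$, $V_S=WV$, $w=W\mathbf 1$ and $\widehat A_{ia}=e^{\beta\langle q_i,k_{s_a}\rangle}$, its output $\widehat O$ is obtained from the matrix with entries $(\widehat AV_S)_{ij}/(\widehat Aw)_i$ (replaced by $0$ unless $(\widehat Aw)_i>0$) by clipping each entry of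 column $j$ to $[\min_lV_{lj},\max_lV_{lj}]$. Its runtime is the number of elementary operations on real numbers (arithmetic, $\exp$, $\log$, $\sqrt{\cdot}$, $W_0$, comparison, storing a number, drawing a uniform number). **Statement.** Let $t\in(0,1)$, and for each $n\ge1$ let $r$ be $n^{t/2}$ rounded to an adjacent integer, i.e. any integer with $|r-n^{t/2}|<1$. 1. The runtime of WildCat with rank $r$ on inputs $Q,K,V\in\mathbb R^{n\times d}$ is $O(n^{1+t}+d\,n^{1+t/2})$, with an absolute implied constant, in every run (so it is $O(n^{1+t})$ if $d$ is bounded). 2. Let $d=d(n)\in\mathbb N$ and $R=R(n)>0$ be bounded sequences. There is a constant $C>0$, depending only on $t$ and on the sequences $d(\cdot)$ and $R(\cdot)$, such that for all $n\ge1$, all such $r$, all $\beta>0$ and all $Q,K,V\in\mathbb R^{n\times d}$ with $\beta R_QR_K\le R$, the output $\widehat O$ of WildCat with rank $r$ satisfies $$\mathbb E\,\|O-\widehat O\|_{\max}\;\le\; C\,\frac{\log n}{n^{\,0.14\,t\,\left(1+\log\left(1+\log(n)/(\kappa R)\right)\right)}}\;\|V\|_{\max}.$$ -/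

import Mathlib

open scoped ENNReal

noncomputable section

namespace WildCat

/-! ## Norms and exact softmax attention -/

/-- `‖A‖_max`, the largest absolute value of an entry (`0` for a matrix without entries). -/
def maxNorm {m n : ℕ} (A : Matrix (Fin m) (Fin n) ℝ) : ℝ := ⨆ i, ⨆ j, |A i j|

/-- `‖A‖_{2,∞}`, the largest Euclidean norm of a row. -/
def rowNorm {m n : ℕ} (A : Matrix (Fin m) (Fin n) ℝ) : ℝ := ⨆ i, Real.sqrt (∑ j, A i j ^ 2)

/-- The keys with their mean subtracted from every row. -/
def recentre {n d : ℕ} (K : Matrix (Fin n) (Fin d) ℝ) : Matrix (Fin n) (Fin d) ℝ :=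
  Matrix.of fun l j => K l j - (∑ i, K i j) / n

/-- The softmax matrix `O = D⁻¹ A V` with `A i l = exp (β ⟨q i, k l⟩)` and `D = diag (A 1)`. -/
def softmaxAttention {m n d : ℕ} (β : ℝ) (Q : Matrix (Fin m) (Fin d) ℝ)
    (K V : Matrix (Fin n) (Fin d) ℝ) : Matrix (Fin m) (Fin d) ℝ :=
  Matrix.of fun i j =>
    (∑ l, Real.exp (β * (Q i ⬝ᵥ K l)) * V l j) / ∑ l, Real.exp (β * (Q i ⬝ᵥ K l))

/-! ## The Lambert W function and the constants -/

/-- The principal branch of the Lambert W function: for `z > -1/e` the unique `w > -1` with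
`w * exp w = z`. Only positive arguments occur below. -/
def lambertW (z : ℝ) : ℝ :=
  open Classical in
  if h : ∃ w : ℝ, -1 < w ∧ w * Real.exp w = z then h.choose else 0

/-- `ρ₀ = √(1 + exp (W₀(2/e²) + 2)) ≈ 3.19`. -/
def rho0 : ℝ := Real.sqrt (1 + Real.exp (lambertW (2 / Real.exp 1 ^ 2) + 2))

/-- `κ = 2 ρ₀ + 1`. -/
def kappa : ℝ := 2 * rho0 + 1

/-! ## Cost model: real-number programs with a count of elementary operations

`Timed α` is a value together with the number of elementary operations spent on it. Arithmetic,
`exp`, `log`, `√`, `W₀`, a comparison, and storing one number cost one unit each. -/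

structure Timed (α : Type) where
  val : α
  cost : ℕ

instance : Monad Timed where
  pure a := ⟨a, 0⟩
  bind x f := ⟨(f x.val).val, x.cost + (f x.val).cost⟩

def addT (x y : ℝ) : Timed ℝ := ⟨x + y, 1⟩
def subT (x y : ℝ) : Timed ℝ := ⟨x - y, 1⟩
def mulT (x y : ℝ) : Timed ℝ := ⟨x * y, 1⟩
def divT (x y : ℝ) : Timed ℝ := ⟨x / y, 1⟩
def expT (x : ℝ) : Timed ℝ := ⟨Real.exp x, 1⟩
def logT (x : ℝ) : Timed ℝ := ⟨Real.log x, 1⟩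
def sqrtT (x : ℝ) : Timed ℝ := ⟨Real.sqrt x, 1⟩
def lambertT (x : ℝ) : Timed ℝ := ⟨lambertW x, 1⟩
def maxT (x y : ℝ) : Timed ℝ := ⟨max x y, 1⟩
def minT (x y : ℝ) : Timed ℝ := ⟨min x y, 1⟩

/-- Compute and store the `k` entries of a vector. -/
def tabT {k : ℕ} (f : Fin k → Timed ℝ) : Timed (Fin k → ℝ) :=
  ⟨fun i => (f i).val, (∑ i, (f i).cost) + k⟩

/-- Compute and store the entries of a matrix. -/
def tabMatT {m k : ℕ} (f : Fin m → Fin k → Timed ℝ) : Timed (Matrix (Fin m) (Fin k) ℝ) :=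
  ⟨Matrix.of fun i j => (f i j).val, (∑ i, ∑ j, (f i j).cost) + m * k⟩

/-- Compute `k` numbers and add them up. -/
def sumT {k : ℕ} (f : Fin k → Timed ℝ) : Timed ℝ :=
  ⟨∑ i, (f i).val, (∑ i, (f i).cost) + k⟩

/-- Compute `k` numbers and take their maximum. -/
def supT {k : ℕ} (f : Fin k → Timed ℝ) : Timed ℝ :=
  ⟨⨆ i, (f i).val, (∑ i, (f i).cost) + k⟩

/-- Compute `k` numbers and take their minimum. -/
def infT {k : ℕ} (f : Fin k → Timed ℝ) : Timed ℝ :=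
  ⟨⨅ i, (f i).val, (∑ i, (f i).cost) + k⟩

/-- The Euclidean inner product. -/
def dotT {k : ℕ} (x y : Fin k → ℝ) : Timed ℝ := sumT fun j => mulT (x j) (y j)

/-- The row norm of a matrix. -/
def rowNormT {m k : ℕ} (A : Matrix (Fin m) (Fin k) ℝ) : Timed ℝ :=
  supT fun i => do
    let z ← dotT (A i) (A i)
    sqrtT z

/-- Randomised programs: the joint law of the result and of its operation count. -/
def RandT (α : Type) : Type := PMF (Timed α)

instance : Monad RandT where
  pure a := PMF.pure ⟨a, 0⟩
  bind x f := PMF.bind x fun a =>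
    PMF.map (fun b => (⟨b.val, a.cost + b.cost⟩ : Timed _)) (f a.val)

/-- A deterministic program seen as a randomised one. -/
def RandT.lift {α : Type} (x : Timed α) : RandT α := PMF.pure x

/-- All possible pairs (result, operation count). -/
def RandT.outcomes {α : Type} (x : RandT α) : Set (Timed α) := PMF.support x

/-- The expectation of a nonnegative function of the result. -/
def RandT.expect {α : Type} (x : RandT α) (f : α → ℝ) : ℝ≥0∞ :=
  ∑' ω : Timed α, (show PMF (Timed α) from x) ω * ENNReal.ofReal (f ω.val)

/-- Sample an index with probability proportional to the weights `p`, at the cost of adding up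
the weights, testing the total, drawing one uniform number and scanning the partial sums.
The result is `none` when no weight is positive. -/
def samplePivot {n : ℕ} (p : Fin n → ℝ) : RandT (Option (Fin n)) :=
  open Classical in
  if h : ∑' l, ENNReal.ofReal (p l) = 0 then PMF.pure ⟨none, n + 1⟩
  else PMF.map (fun s => (⟨some s, 3 * n + 2⟩ : Timed (Option (Fin n))))
    (PMF.normalize (fun l => ENNReal.ofReal (p l)) h (by
      rw [tsum_fintype]
      exact ENNReal.sum_ne_top.2 fun _ _ => ENNReal.ofReal_ne_top))

/-! ## Randomly pivoted Nyström -/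

/-- The variables of the loop: selected keys, inverse kernel matrix, kernel rows, and the diagonal
of the residual kernel. Rows not filled yet are zero. -/
structure NysState (n d r : ℕ) where
  KS : Matrix (Fin r) (Fin d) ℝ
  M : Matrix (Fin r) (Fin r) ℝ
  R : Matrix (Fin r) (Fin n) ℝ
  p : Fin n → ℝ

/-- Overwrite row `i` of a matrix. -/
def setRow {r k : ℕ} (A : Matrix (Fin r) (Fin k) ℝ) (i : ℕ) (v : Fin k → ℝ) :
    Matrix (Fin r) (Fin k) ℝ :=
  Matrix.of fun a b => if a.val = i then v b else A a b

/-- `exp (β ⟨x, y⟩ / τ²)`. -/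
def kernelT {d : ℕ} (β τ : ℝ) (x y : Fin d → ℝ) : Timed ℝ := do
  let z ← dotT x y
  let z ← mulT β z
  let u ← mulT τ τ
  let z ← divT z u
  expT z

/-- The update after the pivot `s` has been selected in round `i` (counted from `0`). -/
def nysUpdate {n d r : ℕ} (h : (Fin d → ℝ) → (Fin d → ℝ) → Timed ℝ)
    (K : Matrix (Fin n) (Fin d) ℝ) (i : ℕ) (s : Fin n) (st : NysState n d r) :
    Timed (NysState n d r) := do
  let ks ← tabT fun j => pure (K s j)
  let root ← sqrtT (st.p s)
  let g ← tabT fun a : Fin r =>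
    if a.val < i then do
      let z ← dotT (st.M a) (fun b => st.R b s)
      divT z root
    else if a.val = i then divT (-1) root
    else pure 0
  let M ← tabMatT fun a b => do
    let z ← mulT (g a) (g b)
    addT (st.M a b) z
  let row ← tabT fun l => h (K s) (K l)
  let R := setRow st.R i row
  let δ ← tabT fun l => dotT g (fun a => R a l)
  let p ← tabT fun l =>
    if l = s then pure 0
    else do
      let z ← mulT (δ l) (δ l)
      subT (st.p l) z
  pure ⟨setRow st.KS i ks, M, R, p⟩

/-- Round `i`: sample a pivot and update. Nothing remains to be done once the residual diagonal
vanishes, that is, once the kernel matrix is reproduced exactly. -/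
def nysRound {n d r : ℕ} (h : (Fin d → ℝ) → (Fin d → ℝ) → Timed ℝ)
    (K : Matrix (Fin n) (Fin d) ℝ) (i : ℕ) (st : NysState n d r) : RandT (NysState n d r) := do
  let o ← samplePivot st.p
  match o with
  | none => pure st
  | some s => RandT.lift (nysUpdate h K i s st)

/-- The first `k` rounds. -/
def nysLoop {n d r : ℕ} (h : (Fin d → ℝ) → (Fin d → ℝ) → Timed ℝ)
    (K : Matrix (Fin n) (Fin d) ℝ) (st : NysState n d r) : ℕ → RandT (NysState n d r)
  | 0 => pure st
  | k + 1 => do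
    let st ← nysLoop h K st k
    nysRound h K k st

/-- Randomly pivoted Nyström with rank `r`: the coreset of keys and the Nyström weights
`W = M R`. If the loop has nothing left to do before round `r`, the remaining rows are zero
and so are their weights. -/
def rpNys {n d : ℕ} (h : (Fin d → ℝ) → (Fin d → ℝ) → Timed ℝ) (r : ℕ)
    (K : Matrix (Fin n) (Fin d) ℝ) :
    RandT (Matrix (Fin r) (Fin d) ℝ × Matrix (Fin r) (Fin n) ℝ) := do
  let p ← RandT.lift (tabT fun l => h (K l) (K l))
  let KS ← RandT.lift (tabMatT fun _ _ => pure 0)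
  let M ← RandT.lift (tabMatT fun _ _ => pure 0)
  let R ← RandT.lift (tabMatT fun _ _ => pure 0)
  let st ← nysLoop h K ⟨KS, M, R, p⟩ r
  let W ← RandT.lift (tabMatT fun a l => dotT (st.M a) (fun b => st.R b l))
  pure (st.KS, W)

/-! ## The attention approximation -/

/-- The temperature `τ = √((R_K / R_Q) (b₀ / (2 W₀(b₀ / (2 ρ₀)))))`, where
`b₀ = log n / (β R_Q R_K) + 2`. In the degenerate case `R_Q R_K = 0`, where the formula makes no
sense (`τ` tends to infinity as `R_Q` tends to zero), the value is `0`, and as `x / 0 = 0` the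
kernel `exp (β ⟨x, y⟩ / τ²)` is then constantly `1`, as it is for `τ = ∞`. -/
def temperatureT (β RQ RK : ℝ) (n : ℕ) : Timed ℝ := do
  let L ← logT n
  let u ← mulT β RQ
  let u ← mulT u RK
  let u ← divT L u
  let b₀ ← addT u 2
  let v ← mulT 2 rho0
  let v ← divT b₀ v
  let v ← lambertT v
  let v ← mulT 2 v
  let v ← divT b₀ v
  let q ← divT RK RQ
  let v ← mulT q v
  sqrtT v

theorem temperatureT_val (β RQ RK : ℝ) (n : ℕ) :
    (temperatureT β RQ RK n).val =
      Real.sqrt (RK / RQ * ((Real.log n / (β * RQ * RK) + 2) /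
        (2 * lambertW ((Real.log n / (β * RQ * RK) + 2) / (2 * rho0))))) := rfl

/-- Compressed keys, compressed values and normalisation weights, with a single bin. -/
def compressKV {n d : ℕ} (β RQ : ℝ) (r : ℕ) (K V : Matrix (Fin n) (Fin d) ℝ) :
    RandT (Matrix (Fin r) (Fin d) ℝ × Matrix (Fin r) (Fin d) ℝ × (Fin r → ℝ)) := do
  let mean ← RandT.lift (tabT fun j => do
    let z ← sumT fun l => pure (K l j)
    divT z n)
  let Kc ← RandT.lift (tabMatT fun l j => subT (K l j) (mean j))
  let RK ← RandT.lift (rowNormT Kc)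
  let τ ← RandT.lift (temperatureT β RQ RK n)
  let c ← rpNys (kernelT β τ) r Kc
  let KS ← RandT.lift (tabMatT fun a j => addT (c.1 a j) (mean j))
  let VS ← RandT.lift (tabMatT fun a j => dotT (c.2 a) (fun l => V l j))
  let w ← RandT.lift (tabT fun a => sumT fun l => pure (c.2 a l))
  pure (KS, VS, w)

/-- Weighted attention over a coreset, clipped to the range of the values. -/
def wtdAttn {m r d : ℕ} (β : ℝ) (Q : Matrix (Fin m) (Fin d) ℝ) (KS VS : Matrix (Fin r) (Fin d) ℝ)
    (w : Fin r → ℝ) (vmin vmax : Fin d → ℝ) : Timed (Matrix (Fin m) (Fin d) ℝ) := do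
  let A ← tabMatT fun i a => do
    let z ← dotT (Q i) (KS a)
    let z ← mulT β z
    expT z
  let D ← tabT fun i => dotT (A i) w
  tabMatT fun i j => do
    let x ← dotT (A i) (fun a => VS a j)
    let y ← divT x (D i)
    let y ← (⟨if 0 < D i then y else 0, 1⟩ : Timed ℝ)
    let y ← maxT (vmin j) y
    minT (vmax j) y

/-- WildCat with scale `β`, rank `r` and a single bin. -/
def wildCat {m n d : ℕ} (β : ℝ) (r : ℕ) (Q : Matrix (Fin m) (Fin d) ℝ)
    (K V : Matrix (Fin n) (Fin d) ℝ) : RandT (Matrix (Fin m) (Fin d) ℝ) := do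
  let vmin ← RandT.lift (tabT fun j => infT fun l => pure (V l j))
  let vmax ← RandT.lift (tabT fun j => supT fun l => pure (V l j))
  let RQ ← RandT.lift (rowNormT Q)
  let c ← compressKV β RQ r K V
  RandT.lift (wtdAttn β Q c.1 c.2.1 c.2.2 vmin vmax)

end WildCat

end

namespace WildCat

/-! ## Randomised programs -/

/-! The kernel at temperature τ is an inner product of feature vectors, so pivoted Nyström is
Gram–Schmidt in disguise. The residuals (feature minus approximation) form a family in a Hilbert
space, `p` holds their squared norms, and a pivot `s` replaces every member by its component
orthogonal to the `s`-th (`NysInvariant.update`). The loop is a random deflation, whose error is the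
energy, the sum of squared norms.

Let δ_k be the least squared error of a rank-k approximation of the initial family. Two one-round
estimates control the expected energy. The expected rank-j tail after a round is at most 6 times the
rank-(j+1) tail before it (`sum_mul_tailEnergy_deflate_le`), so k rounds reach 6^k δ_k whatever the
initial energy. A round also sends the energy E to at most (1 - 1/k) E + (2/k) δ_k on average
(`sum_mul_energy_deflate_le`). About 2k² further rounds absorb the factor 6^k, so r ≥ 3k² rounds
give 3 δ_k (`mean_nysLoop_energy_le_three_mul`). Cutting the exponential series below degree s in
each coordinate gives k = s^d and a factorially small δ_k (`tailEnergy_expFeature_le`).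

The errors of the softmax numerator and denominator are pairings of query features with residuals.
Cauchy–Schwarz and clipping bound the output error by the query feature norm times the root of the
energy (`maxNorm_sub_nysOutput_le`). Of the temperature only two consequences matter: scaled keys
have squared norm at most R, and query features have squared norm at most n e^{2R} (from
`temperatureT_cases`).

Finally s = ⌈6 log n⌉. Then k² is polylogarithmic, hence below n^{t/2} for large n, while R^s/s! ≤
n^{-6θ} with θ = 1 + log(1 + log n/(κR)). Its root n^{-3θ} beats the lost factor n and the claimed
n^{-0.14tθ}. For small n the bound 2‖V‖ from clipping is absorbed into the constant, except at n =
1, where the right side is 0 and the output is exact. The runtime is a direct count. -/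

theorem RandT.mem_outcomes_bind {α β : Type} {x : RandT α} {f : α → RandT β} {ω : Timed β} :
    ω ∈ (x >>= f).outcomes ↔
      ∃ a ∈ x.outcomes, ∃ b ∈ (f a.val).outcomes, ω = ⟨b.val, a.cost + b.cost⟩ := by
  refine (PMF.mem_support_bind_iff (p := (x : PMF (Timed α))) _ _).trans ?_
  refine exists_congr fun a => and_congr Iff.rfl ?_
  refine (PMF.mem_support_map_iff _ (f a.val : PMF (Timed β)) _).trans ?_
  exact exists_congr fun b => and_congr Iff.rfl eq_comm

theorem RandT.mem_outcomes_lift {α : Type} {x ω : Timed α} :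
    ω ∈ (RandT.lift x).outcomes ↔ ω = x := by
  exact PMF.mem_support_pure_iff x ω

theorem RandT.mem_outcomes_pure {α : Type} {x : α} {ω : Timed α} :
    ω ∈ (pure x : RandT α).outcomes ↔ ω = ⟨x, 0⟩ :=
  RandT.mem_outcomes_lift (x := ⟨x, 0⟩)

/-- The expectation of an extended nonnegative function of the result. -/
noncomputable def RandT.mean {α : Type} (x : RandT α) (g : α → ℝ≥0∞) : ℝ≥0∞ :=
  ∑' ω : Timed α, (show PMF (Timed α) from x) ω * g ω.val

theorem RandT.expect_eq_mean {α : Type} (x : RandT α) (f : α → ℝ) :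
    x.expect f = x.mean fun a => ENNReal.ofReal (f a) := rfl

/-- Conditioning on the first draw. In `ℝ≥0∞` the sums may be exchanged without any summability
condition. -/
theorem tsum_bind_mul {α β : Type} (p : PMF α) (f : α → PMF β) (g : β → ℝ≥0∞) :
    ∑' b, (p.bind f) b * g b = ∑' a, p a * ∑' b, f a b * g b := by
  simp_rw [PMF.bind_apply, ← ENNReal.tsum_mul_right]
  rw [ENNReal.tsum_comm]
  simp_rw [mul_assoc, ENNReal.tsum_mul_left]

theorem tsum_pure_mul {α : Type} (a : α) (g : α → ℝ≥0∞) :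
    ∑' b, (PMF.pure a) b * g b = g a := by
  classical
  rw [tsum_eq_single a]
  · simp
  · intro b hb
    simp [PMF.pure_apply, hb]

theorem tsum_map_mul {α β : Type} (p : PMF α) (h : α → β) (g : β → ℝ≥0∞) :
    ∑' b, (p.map h) b * g b = ∑' a, p a * g (h a) := by
  rw [← PMF.bind_pure_comp, tsum_bind_mul]
  simp_rw [Function.comp, tsum_pure_mul]

theorem RandT.mean_bind {α β : Type} (x : RandT α) (f : α → RandT β) (g : β → ℝ≥0∞) :
    (x >>= f).mean g = x.mean fun a => (f a).mean g := by
  refine (tsum_bind_mul _ _ _).trans ?_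
  exact tsum_congr fun a => congrArg (fun z => (show PMF (Timed α) from x) a * z)
    (tsum_map_mul (show PMF (Timed β) from f a.val) _ fun ω : Timed β => g ω.val)

theorem RandT.mean_lift {α : Type} (x : Timed α) (g : α → ℝ≥0∞) :
    (RandT.lift x).mean g = g x.val :=
  tsum_pure_mul x fun ω => g ω.val

theorem RandT.mean_pure {α : Type} (x : α) (g : α → ℝ≥0∞) :
    (pure x : RandT α).mean g = g x :=
  RandT.mean_lift ⟨x, 0⟩ g

/-- The comparison is needed only on outcomes of positive probability, which is what lets loop
invariants enter expectations. -/
theorem RandT.mean_mono {α : Type} {x : RandT α} {f g : α → ℝ≥0∞}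
    (h : ∀ ω ∈ x.outcomes, f ω.val ≤ g ω.val) : x.mean f ≤ x.mean g := by
  refine ENNReal.tsum_le_tsum fun ω => ?_
  by_cases hω : ω ∈ x.outcomes
  · exact mul_le_mul_right (h ω hω) _
  · have : (show PMF (Timed α) from x) ω = 0 := by
      exact (PMF.apply_eq_zero_iff (x : PMF (Timed α)) ω).2 hω
    simp [this]

theorem RandT.mean_const {α : Type} (x : RandT α) (c : ℝ≥0∞) : x.mean (fun _ => c) = c := by
  refine ENNReal.tsum_mul_right.trans ?_
  rw [PMF.tsum_coe, one_mul]

theorem RandT.mean_add {α : Type} (x : RandT α) (f g : α → ℝ≥0∞) :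
    x.mean (fun a => f a + g a) = x.mean f + x.mean g := by
  simp_rw [RandT.mean, mul_add]
  exact ENNReal.tsum_add

theorem RandT.mean_const_mul {α : Type} (x : RandT α) (c : ℝ≥0∞) (f : α → ℝ≥0∞) :
    x.mean (fun a => c * f a) = c * x.mean f := by
  simp_rw [RandT.mean, ← ENNReal.tsum_mul_left]
  exact tsum_congr fun _ => by ring

/-! ## Rejection of a vector, energy and tails of a finite family -/

section Energy

variable {H : Type*} [NormedAddCommGroup H] [InnerProductSpace ℝ H]

/-- The component of a vector orthogonal to `a`. -/
noncomputable def reject (a : H) : H →ₗ[ℝ] H where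
  toFun x := x - (inner ℝ a x / ‖a‖ ^ 2) • a
  map_add' x y := by simp only [inner_add_right, add_div, add_smul]; abel
  map_smul' c x := by
    simp only [inner_smul_right, RingHom.id_apply, smul_sub, smul_smul, mul_div_assoc]

theorem reject_apply (a x : H) : reject a x = x - (inner ℝ a x / ‖a‖ ^ 2) • a := rfl

theorem inner_reject (a x : H) : inner ℝ a (reject a x) = 0 := by
  rcases eq_or_ne a 0 with rfl | ha
  · simp
  · have : ‖a‖ ^ 2 ≠ 0 := by positivity
    rw [reject_apply, inner_sub_right, inner_smul_right, real_inner_self_eq_norm_sq,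
      div_mul_cancel₀ _ this, sub_self]

theorem reject_self (a : H) : reject a a = 0 := by
  rcases eq_or_ne a 0 with rfl | ha
  · simp
  · have : ‖a‖ ^ 2 ≠ 0 := by positivity
    rw [reject_apply, real_inner_self_eq_norm_sq, div_self this, one_smul, sub_self]

theorem reject_of_inner_eq_zero {a x : H} (h : inner ℝ a x = 0) : reject a x = x := by
  simp [reject_apply, h]

theorem inner_reject_left (a x y : H) :
    inner ℝ (reject a x) y = inner ℝ x y - inner ℝ a x * inner ℝ a y / ‖a‖ ^ 2 := by
  rw [reject_apply, inner_sub_left, real_inner_smul_left]; ring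

theorem inner_reject_reject (a x y : H) :
    inner ℝ (reject a x) (reject a y) = inner ℝ x y - inner ℝ a x * inner ℝ a y / ‖a‖ ^ 2 := by
  rw [inner_reject_left, inner_reject, mul_zero, zero_div, sub_zero, real_inner_comm,
    inner_reject_left, real_inner_comm x y]
  ring

theorem norm_reject_sq (a x : H) :
    ‖reject a x‖ ^ 2 = ‖x‖ ^ 2 - inner ℝ a x ^ 2 / ‖a‖ ^ 2 := by
  rw [← real_inner_self_eq_norm_sq, inner_reject_reject, real_inner_self_eq_norm_sq, sq (inner ℝ a x)]

theorem norm_reject_sq_le (a x : H) : ‖reject a x‖ ^ 2 ≤ ‖x‖ ^ 2 := by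
  rw [norm_reject_sq]
  have : 0 ≤ inner ℝ a x ^ 2 / ‖a‖ ^ 2 := by positivity
  linarith

variable {ι : Type*} [Fintype ι]

/-- The total squared norm of a family. -/
noncomputable def energy (v : ι → H) : ℝ := ∑ l, ‖v l‖ ^ 2

/-- The components of a family orthogonal to its `s`-th member. -/
noncomputable def deflate (v : ι → H) (s : ι) : ι → H := fun l => reject (v s) (v l)

/-- The least squared error of an approximation of a family by one of rank at most `j`. -/
noncomputable def tailEnergy (j : ℕ) (v : ι → H) : ℝ :=
  ⨅ w : {w : ι → H // Set.finrank ℝ (Set.range w) ≤ j}, energy (v - w.1)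

omit [InnerProductSpace ℝ H] in
theorem energy_nonneg (v : ι → H) : 0 ≤ energy v := Finset.sum_nonneg fun _ _ => sq_nonneg _

omit [InnerProductSpace ℝ H] in
theorem energy_eq_zero {v : ι → H} : energy v = 0 ↔ v = 0 := by
  rw [energy, Finset.sum_eq_zero_iff_of_nonneg fun _ _ => sq_nonneg _]
  simp [funext_iff]

theorem energy_reject_le (a : H) (v : ι → H) : energy (fun l => reject a (v l)) ≤ energy v :=
  Finset.sum_le_sum fun _ _ => norm_reject_sq_le _ _

theorem energy_deflate_le (v : ι → H) (s : ι) : energy (deflate v s) ≤ energy v :=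
  energy_reject_le _ _

omit [Fintype ι] in
theorem finrank_range_zero (j : ℕ) : Set.finrank ℝ (Set.range (0 : ι → H)) ≤ j := by
  have : Submodule.span ℝ (Set.range (0 : ι → H)) = ⊥ := by
    rw [Submodule.span_eq_bot]
    rintro _ ⟨i, rfl⟩
    rfl
  rw [Set.finrank, this, finrank_bot]
  exact Nat.zero_le j

instance (j : ℕ) : Nonempty {w : ι → H // Set.finrank ℝ (Set.range w) ≤ j} :=
  ⟨⟨0, finrank_range_zero j⟩⟩

theorem bddBelow_energy_sub (j : ℕ) (v : ι → H) : BddBelow (Set.range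
    fun w : {w : ι → H // Set.finrank ℝ (Set.range w) ≤ j} => energy (v - w.1)) :=
  ⟨0, by rintro _ ⟨w, rfl⟩; exact energy_nonneg _⟩

theorem tailEnergy_le {j : ℕ} (v w : ι → H) (hw : Set.finrank ℝ (Set.range w) ≤ j) :
    tailEnergy j v ≤ energy (v - w) :=
  ciInf_le (bddBelow_energy_sub j v) ⟨w, hw⟩

theorem le_tailEnergy {j : ℕ} {v : ι → H} {c : ℝ}
    (h : ∀ w : ι → H, Set.finrank ℝ (Set.range w) ≤ j → c ≤ energy (v - w)) :
    c ≤ tailEnergy j v :=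
  le_ciInf fun w => h w.1 w.2

theorem tailEnergy_nonneg (j : ℕ) (v : ι → H) : 0 ≤ tailEnergy j v :=
  le_tailEnergy fun _ _ => energy_nonneg _

theorem tailEnergy_le_energy (j : ℕ) (v : ι → H) : tailEnergy j v ≤ energy v := by
  simpa using tailEnergy_le v 0 (finrank_range_zero j)

theorem tailEnergy_zero (v : ι → H) : tailEnergy 0 v = energy v := by
  refine le_antisymm (tailEnergy_le_energy 0 v) (le_tailEnergy fun w hw => ?_)
  have hw0 : w = 0 := by
    have : FiniteDimensional ℝ (Submodule.span ℝ (Set.range w)) :=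
      FiniteDimensional.span_of_finite ℝ (Set.finite_range w)
    have h := Submodule.finrank_eq_zero.1 (Nat.le_zero.1 hw)
    funext i
    have hi : w i ∈ Submodule.span ℝ (Set.range w) := Submodule.subset_span ⟨i, rfl⟩
    rw [h] at hi
    simpa using hi
  simp [hw0]

theorem finrank_range_map_le (f : H →ₗ[ℝ] H) (w : ι → H) :
    Set.finrank ℝ (Set.range fun l => f (w l)) ≤ Set.finrank ℝ (Set.range w) := by
  have : FiniteDimensional ℝ (Submodule.span ℝ (Set.range w)) :=
    FiniteDimensional.span_of_finite ℝ (Set.finite_range w)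
  have h : Submodule.span ℝ (Set.range fun l => f (w l)) =
      (Submodule.span ℝ (Set.range w)).map f := by
    rw [Submodule.map_span, ← Set.range_comp]; rfl
  rw [Set.finrank, h]
  exact Submodule.finrank_map_le f _

/-- Rejection along `v s` raises neither the rank of a competitor nor the energy of its error. Hence
the tail of the initial family bounds the tail in every later round. -/
theorem tailEnergy_deflate_le (j : ℕ) (v : ι → H) (s : ι) :
    tailEnergy j (deflate v s) ≤ tailEnergy j v := by
  refine le_tailEnergy fun w hw => ?_
  refine (tailEnergy_le (deflate v s) (fun l => reject (v s) (w l))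
    ((finrank_range_map_le _ _).trans hw)).trans ?_
  have : deflate v s - (fun l => reject (v s) (w l)) = fun l => reject (v s) ((v - w) l) := by
    funext l; simp [deflate]
  rw [this]
  exact energy_reject_le _ _

omit [Fintype ι] in
theorem finrank_range_le_of_mem {w : ι → H} {U : Submodule ℝ H} [FiniteDimensional ℝ U]
    (h : ∀ l, w l ∈ U) : Set.finrank ℝ (Set.range w) ≤ Module.finrank ℝ U :=
  Submodule.finrank_mono (Submodule.span_le.2 (by rintro _ ⟨l, rfl⟩; exact h l))

/-- A family approximated by one of rank at most `j` is the sum of a family in a subspace of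
dimension at most `j` and a family orthogonal to that subspace, not larger than the error. -/
theorem exists_orthogonal_splitting {j : ℕ} (v w : ι → H)
    (hw : Set.finrank ℝ (Set.range w) ≤ j) :
    ∃ (U : Submodule ℝ H) (u e : ι → H), FiniteDimensional ℝ U ∧ Module.finrank ℝ U ≤ j ∧
      v = u + e ∧ (∀ l, u l ∈ U) ∧ (∀ l, ∀ x ∈ U, inner ℝ x (e l) = 0) ∧
      energy e ≤ energy (v - w) := by
  have hfd : FiniteDimensional ℝ (Submodule.span ℝ (Set.range w)) :=
    FiniteDimensional.span_of_finite ℝ (Set.finite_range w)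
  set U := Submodule.span ℝ (Set.range w) with hU
  refine ⟨U, fun l => U.starProjection (v l), fun l => v l - U.starProjection (v l), hfd, hw,
    ?_, fun l => Submodule.starProjection_apply_mem U _, fun l x hx => ?_, ?_⟩
  · funext l; simp
  · exact U.inner_right_of_mem_orthogonal hx (Submodule.sub_starProjection_mem_orthogonal _)
  · refine Finset.sum_le_sum fun l _ => ?_
    have hwl : w l ∈ U := Submodule.subset_span ⟨l, rfl⟩
    have h1 : inner ℝ (v l - U.starProjection (v l)) (U.starProjection (v l) - w l) = 0 :=
      U.inner_left_of_mem_orthogonal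
        (U.sub_mem (Submodule.starProjection_apply_mem U _) hwl)
        (Submodule.sub_starProjection_mem_orthogonal _)
    have h2 : (v - w) l = (v l - U.starProjection (v l)) + (U.starProjection (v l) - w l) := by
      simp
    rw [h2, norm_add_sq_real, h1]
    nlinarith [sq_nonneg ‖U.starProjection (v l) - w l‖]

theorem norm_add_sq_of_inner_eq_zero {x y : H} (h : inner ℝ x y = 0) :
    ‖x + y‖ ^ 2 = ‖x‖ ^ 2 + ‖y‖ ^ 2 := by
  rw [norm_add_sq_real, h]; ring

theorem norm_sub_sq_le_two_mul (x y : H) : ‖x - y‖ ^ 2 ≤ 2 * ‖x‖ ^ 2 + 2 * ‖y‖ ^ 2 := by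
  nlinarith [parallelogram_law_with_norm ℝ x y, sq_nonneg ‖x + y‖]

/-- Deflating by a pivot drawn with probability proportional to the squared norm lowers the rank
at the price of a factor `6`. -/
theorem sum_mul_tailEnergy_deflate_le (j : ℕ) (v : ι → H) :
    ∑ s, ‖v s‖ ^ 2 * tailEnergy j (deflate v s) ≤ 6 * tailEnergy (j + 1) v * energy v := by
  have key : ∀ w : ι → H, Set.finrank ℝ (Set.range w) ≤ j + 1 →
      ∑ s, ‖v s‖ ^ 2 * tailEnergy j (deflate v s) ≤ 6 * energy (v - w) * energy v := by
    intro w hw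
    obtain ⟨U, u, e, hfd, hU, hv, hu, he, hle⟩ := exists_orthogonal_splitting v w hw
    have hnorm : ∀ l, ‖v l‖ ^ 2 = ‖u l‖ ^ 2 + ‖e l‖ ^ 2 := fun l => by
      rw [hv]; exact norm_add_sq_of_inner_eq_zero (he l _ (hu l))
    have hT := energy_nonneg v
    have hE := energy_nonneg e
    have step : ∀ s, ‖v s‖ ^ 2 * tailEnergy j (deflate v s) ≤
        2 * energy e * ‖v s‖ ^ 2 + 4 * energy v * ‖e s‖ ^ 2 := by
      intro s
      -- A pivot dominated by its error part satisfies ‖v s‖² ≤ 2‖e s‖², so its weight is small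
      -- enough to bound the tail by the whole energy. The case `‖u s‖ = 0` is included so that the
      -- other branch can divide by it.
      by_cases hs : ‖u s‖ ^ 2 < ‖e s‖ ^ 2 ∨ ‖u s‖ = 0
      · have h1 : ‖v s‖ ^ 2 ≤ 2 * ‖e s‖ ^ 2 := by
          rcases hs with hs | hs
          · rw [hnorm]; linarith
          · rw [hnorm, hs]; nlinarith [sq_nonneg ‖e s‖]
        have h2 : tailEnergy j (deflate v s) ≤ energy v :=
          (tailEnergy_le_energy _ _).trans (energy_deflate_le _ _)
        calc ‖v s‖ ^ 2 * tailEnergy j (deflate v s) ≤ (2 * ‖e s‖ ^ 2) * energy v :=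
              mul_le_mul h1 h2 (tailEnergy_nonneg _ _) (by positivity)
          _ ≤ _ := by nlinarith [mul_nonneg hE (sq_nonneg ‖v s‖), mul_nonneg hT (sq_nonneg ‖e s‖)]
      · push Not at hs
        obtain ⟨hs1, hs0⟩ := hs
        have hpos : 0 < ‖u s‖ ^ 2 := by positivity
        have hus0 : u s ≠ 0 := norm_ne_zero_iff.1 hs0
        -- The competitor: removing the direction `u s` from `U` loses one dimension.
        set w' : ι → H := fun l => reject (u s) (u l) with hw'
        have hw'U : ∀ l, w' l ∈ U := fun l =>
          U.sub_mem (hu l) (U.smul_mem _ (hu s))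
        have hrank : Set.finrank ℝ (Set.range w') ≤ j := by
          have hlt : U ⊓ (ℝ ∙ u s)ᗮ < U := by
            refine lt_of_le_of_ne inf_le_left fun h => hus0 ?_
            have : u s ∈ U ⊓ (ℝ ∙ u s)ᗮ := by rw [h]; exact hu s
            exact inner_self_eq_zero.1 ((Submodule.mem_orthogonal_singleton_iff_inner_right).1 this.2)
          have h1 := Submodule.finrank_lt_finrank_of_lt hlt
          have h2 : Set.finrank ℝ (Set.range w') ≤
              Module.finrank ℝ (U ⊓ (ℝ ∙ u s)ᗮ : Submodule ℝ H) := by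
            have : FiniteDimensional ℝ (U ⊓ (ℝ ∙ u s)ᗮ : Submodule ℝ H) :=
              Submodule.finiteDimensional_of_le inf_le_left
            exact finrank_range_le_of_mem fun l => ⟨hw'U l,
              (Submodule.mem_orthogonal_singleton_iff_inner_right).2 (inner_reject _ _)⟩
          omega
        have herr : energy (deflate v s - w') ≤
            2 * energy e + 2 * (energy v / ‖u s‖ ^ 2) * ‖e s‖ ^ 2 := by
          have hl : ∀ l, ‖(deflate v s - w') l‖ ^ 2 ≤
              2 * ‖e l‖ ^ 2 + 2 * (‖v l‖ ^ 2 / ‖u s‖ ^ 2) * ‖e s‖ ^ 2 := by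
            intro l
            set a := inner ℝ (u s) (u l) / ‖u s‖ ^ 2 with ha
            have hperp : inner ℝ (v s) (w' l) = 0 := by
              have h1 : v s = u s + e s := by rw [hv]; rfl
              rw [h1, inner_add_left, hw', inner_reject, zero_add, real_inner_comm]
              exact he s _ (hw'U l)
            -- `w' l` is orthogonal to `v s`, and rejection kills multiples of `v s`. Subtracting `a
            -- • v s` cancels the parts in `U`, so only errors `e` remain.
            have heq : (deflate v s - w') l = reject (v s) (e l - a • e s) := by
              have h1 : e l - a • e s = (v l - w' l) - a • v s := by
                rw [hv]
                simp only [hw', reject_apply, Pi.add_apply, ← ha]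
                module
              rw [h1, map_sub, map_sub, map_smul, reject_self, smul_zero, sub_zero,
                reject_of_inner_eq_zero hperp]
              rfl
            have ha2 : a ^ 2 ≤ ‖v l‖ ^ 2 / ‖u s‖ ^ 2 := by
              have h1 : inner ℝ (u s) (u l) ^ 2 ≤ ‖u s‖ ^ 2 * ‖u l‖ ^ 2 := by
                rw [← mul_pow, sq_le_sq, abs_of_nonneg (by positivity : 0 ≤ ‖u s‖ * ‖u l‖)]
                exact abs_real_inner_le_norm _ _
              have h2 : ‖u l‖ ^ 2 ≤ ‖v l‖ ^ 2 := by rw [hnorm]; nlinarith [sq_nonneg ‖e l‖]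
              rw [ha, div_pow, div_le_div_iff₀ (by positivity) hpos]
              nlinarith [mul_le_mul_of_nonneg_left h2 hpos.le]
            rw [heq]
            refine (norm_reject_sq_le _ _).trans ((norm_sub_sq_le_two_mul _ _).trans ?_)
            rw [norm_smul, mul_pow, Real.norm_eq_abs, sq_abs]
            nlinarith [mul_le_mul_of_nonneg_right ha2 (sq_nonneg ‖e s‖)]
          refine (Finset.sum_le_sum fun l _ => hl l).trans (le_of_eq ?_)
          rw [Finset.sum_add_distrib, ← Finset.mul_sum, ← Finset.sum_mul, ← Finset.mul_sum,
            ← Finset.sum_div]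
          rfl
        have h2 : ‖v s‖ ^ 2 ≤ 2 * ‖u s‖ ^ 2 := by rw [hnorm]; linarith
        calc ‖v s‖ ^ 2 * tailEnergy j (deflate v s)
            ≤ ‖v s‖ ^ 2 * (2 * energy e + 2 * (energy v / ‖u s‖ ^ 2) * ‖e s‖ ^ 2) :=
              mul_le_mul_of_nonneg_left ((tailEnergy_le _ _ hrank).trans herr) (sq_nonneg _)
          _ = 2 * energy e * ‖v s‖ ^ 2 +
                ‖v s‖ ^ 2 * (2 * (energy v / ‖u s‖ ^ 2) * ‖e s‖ ^ 2) := by ring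
          _ ≤ 2 * energy e * ‖v s‖ ^ 2 +
                2 * ‖u s‖ ^ 2 * (2 * (energy v / ‖u s‖ ^ 2) * ‖e s‖ ^ 2) := by gcongr
          _ = _ := by field_simp; ring
    calc ∑ s, ‖v s‖ ^ 2 * tailEnergy j (deflate v s)
        ≤ ∑ s, (2 * energy e * ‖v s‖ ^ 2 + 4 * energy v * ‖e s‖ ^ 2) :=
          Finset.sum_le_sum fun s _ => step s
      _ = 2 * energy e * energy v + 4 * energy v * energy e := by
          rw [Finset.sum_add_distrib, ← Finset.mul_sum, ← Finset.mul_sum]; rfl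
      _ = 6 * energy e * energy v := by ring
      _ ≤ _ := by gcongr
  -- Passing to the infimum over `w` requires dividing by the energy; if it is zero, `w = 0` already
  -- suffices.
  rcases (energy_nonneg v).eq_or_lt with h0 | hpos
  · simpa [← h0] using key 0 (finrank_range_zero _)
  · rw [mul_comm (6 : ℝ), mul_assoc, ← div_le_iff₀ (by positivity)]
    refine le_tailEnergy fun w hw => ?_
    rw [div_le_iff₀ (by positivity), ← mul_assoc, mul_comm _ (6 : ℝ)]
    exact key w hw

/-- The squared Frobenius norm of a Gram matrix, seen through a family in a subspace of dimension
at most `k` from which the family differs by an orthogonal one. -/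
theorem sq_energy_le_mul_sum_inner_sq {k : ℕ} {U : Submodule ℝ H} [FiniteDimensional ℝ U]
    (hU : Module.finrank ℝ U ≤ k) (u e : ι → H) (hu : ∀ l, u l ∈ U)
    (he : ∀ l, ∀ x ∈ U, inner ℝ x (e l) = 0) :
    energy u ^ 2 ≤ k * ∑ s, ∑ l, inner ℝ (u s + e s) (u l + e l) ^ 2 := by
  let b := stdOrthonormalBasis ℝ U
  let m := Module.finrank ℝ U
  let c : Fin m → ι → ℝ := fun i l => inner ℝ (b i) (⟨u l, hu l⟩ : U)
  have hinner : ∀ s l, inner ℝ (u s) (u l) = ∑ i, c i s * c i l := by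
    intro s l
    have h := b.sum_inner_mul_inner (⟨u s, hu s⟩ : U) ⟨u l, hu l⟩
    rw [Submodule.coe_inner] at h
    rw [← h]
    exact Finset.sum_congr rfl fun i _ => by rw [real_inner_comm]
  have henergy : energy u = ∑ i, ∑ l, c i l ^ 2 := by
    rw [Finset.sum_comm]
    refine Finset.sum_congr rfl fun l _ => ?_
    rw [← real_inner_self_eq_norm_sq, hinner]
    exact Finset.sum_congr rfl fun i _ => (sq _).symm
  have hsplit : ∀ s l, inner ℝ (u s + e s) (u l + e l) =
      inner ℝ (u s) (u l) + inner ℝ (e s) (e l) := by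
    intro s l
    rw [inner_add_left, inner_add_right, inner_add_right, he l _ (hu s),
      real_inner_comm (u l) (e s), he s _ (hu l)]
    ring
  -- The Frobenius product of two positive semidefinite Gram matrices, written as a sum of squares.
  have hcross : 0 ≤ ∑ s, ∑ l, inner ℝ (u s) (u l) * inner ℝ (e s) (e l) := by
    have : ∑ s, ∑ l, inner ℝ (u s) (u l) * inner ℝ (e s) (e l) =
        ∑ i, ‖∑ l, c i l • e l‖ ^ 2 := by
      simp_rw [← real_inner_self_eq_norm_sq, sum_inner, inner_sum, real_inner_smul_left,
        real_inner_smul_right, hinner, Finset.sum_mul]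
      rw [Finset.sum_comm' (t' := Finset.univ) (s' := fun _ => Finset.univ) (by simp)]
      conv_rhs => rw [Finset.sum_comm]
      rw [Finset.sum_comm]
      refine Finset.sum_congr rfl fun s _ => ?_
      rw [Finset.sum_comm]
      exact Finset.sum_congr rfl fun i _ => Finset.sum_congr rfl fun l _ => by ring
    rw [this]
    exact Finset.sum_nonneg fun _ _ => sq_nonneg _
  -- The Gram matrix over `ι` has the Frobenius norm of the smaller one over the basis of `U`.
  -- Keeping only the diagonal of the latter makes Cauchy–Schwarz cost the dimension, not the number
  -- of vectors.
  have hgram : ∑ i, (∑ l, c i l ^ 2) ^ 2 ≤ ∑ s, ∑ l, inner ℝ (u s) (u l) ^ 2 := by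
    have : ∑ s, ∑ l, inner ℝ (u s) (u l) ^ 2 = ∑ i, ∑ i', (∑ l, c i l * c i' l) ^ 2 := by
      simp_rw [hinner, sq, Finset.sum_mul_sum]
      have h1 : ∀ f : ι → ι → Fin m → Fin m → ℝ,
          ∑ s, ∑ l, ∑ i, ∑ i', f s l i i' = ∑ i, ∑ i', ∑ s, ∑ l, f s l i i' := by
        intro f
        calc ∑ s, ∑ l, ∑ i, ∑ i', f s l i i' = ∑ s, ∑ i, ∑ l, ∑ i', f s l i i' :=
              Finset.sum_congr rfl fun s _ => Finset.sum_comm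
          _ = ∑ i, ∑ s, ∑ l, ∑ i', f s l i i' := Finset.sum_comm
          _ = ∑ i, ∑ s, ∑ i', ∑ l, f s l i i' := Finset.sum_congr rfl fun i _ =>
              Finset.sum_congr rfl fun s _ => Finset.sum_comm
          _ = _ := Finset.sum_congr rfl fun i _ => Finset.sum_comm
      rw [h1]
      refine Finset.sum_congr rfl fun i _ => Finset.sum_congr rfl fun i' _ =>
        Finset.sum_congr rfl fun s _ => Finset.sum_congr rfl fun l _ => by ring
    rw [this]
    refine Finset.sum_le_sum fun i _ => ?_
    refine le_trans (le_of_eq ?_) (Finset.single_le_sum (fun i' _ => sq_nonneg _)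
      (Finset.mem_univ i))
    simp_rw [sq]
  calc energy u ^ 2 ≤ m * ∑ i, (∑ l, c i l ^ 2) ^ 2 := by
        rw [henergy]
        simpa using sq_sum_le_card_mul_sum_sq (s := Finset.univ) (f := fun i => ∑ l, c i l ^ 2)
    _ ≤ k * ∑ i, (∑ l, c i l ^ 2) ^ 2 := by
        gcongr
    _ ≤ k * ∑ s, ∑ l, inner ℝ (u s + e s) (u l + e l) ^ 2 := by
        gcongr
        simp_rw [hsplit, add_sq, Finset.sum_add_distrib, mul_assoc, ← Finset.mul_sum]
        have : 0 ≤ ∑ s, ∑ l, inner ℝ (e s) (e l) ^ 2 :=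
          Finset.sum_nonneg fun _ _ => Finset.sum_nonneg fun _ _ => sq_nonneg _
        linarith

/-- One round of deflation by a pivot drawn with probability proportional to the squared norm
contracts the energy down to the level of the rank-`k` tail. -/
theorem sum_mul_energy_deflate_le {k : ℕ} (hk : 1 ≤ k) (v : ι → H) :
    ∑ s, ‖v s‖ ^ 2 * energy (deflate v s) ≤
      ((1 - 1 / k) * energy v + 2 / k * tailEnergy k v) * energy v := by
  have hk0 : (0 : ℝ) < k := by exact_mod_cast hk
  -- Deflation by `v s` lowers the energy by ∑ ⟨v s, v l⟩² / ‖v s‖²; the sampling weight cancels the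
  -- denominator, leaving the squared Frobenius norm of the Gram matrix.
  have hlhs : ∑ s, ‖v s‖ ^ 2 * energy (deflate v s) =
      energy v ^ 2 - ∑ s, ∑ l, inner ℝ (v s) (v l) ^ 2 := by
    have : ∀ s, ‖v s‖ ^ 2 * energy (deflate v s) =
        ‖v s‖ ^ 2 * energy v - ∑ l, inner ℝ (v s) (v l) ^ 2 := by
      intro s
      rcases eq_or_ne (v s) 0 with h0 | h0
      · simp [h0]
      · have hs : ‖v s‖ ^ 2 ≠ 0 := by positivity
        simp_rw [energy, deflate, norm_reject_sq, Finset.sum_sub_distrib, ← Finset.sum_div]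
        field_simp
    rw [Finset.sum_congr rfl fun s _ => this s, Finset.sum_sub_distrib, ← Finset.sum_mul, sq]
    rfl
  have key : ∀ w : ι → H, Set.finrank ℝ (Set.range w) ≤ k →
      ∑ s, ‖v s‖ ^ 2 * energy (deflate v s) ≤
        ((1 - 1 / k) * energy v + 2 / k * energy (v - w)) * energy v := by
    intro w hw
    obtain ⟨U, u, e, hfd, hU, hv, hu, he, hle⟩ := exists_orthogonal_splitting v w hw
    have h1 := sq_energy_le_mul_sum_inner_sq hU u e hu he
    have hF : ∑ s, ∑ l, inner ℝ (u s + e s) (u l + e l) ^ 2 =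
        ∑ s, ∑ l, inner ℝ (v s) (v l) ^ 2 := by rw [hv]; rfl
    rw [hF] at h1
    have hue : energy v = energy u + energy e := by
      simp only [energy, ← Finset.sum_add_distrib]
      refine Finset.sum_congr rfl fun l _ => ?_
      rw [hv]; exact norm_add_sq_of_inner_eq_zero (he l _ (hu l))
    rw [hlhs]
    set F := ∑ s, ∑ l, inner ℝ (v s) (v l) ^ 2
    have h2 : energy u ^ 2 / k ≤ F := by rw [div_le_iff₀ hk0]; linarith
    have h3 : (energy v ^ 2 - 2 * energy (v - w) * energy v) / k ≤ energy u ^ 2 / k := by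
      gcongr
      nlinarith [energy_nonneg v, energy_nonneg e, energy_nonneg u,
        mul_le_mul_of_nonneg_right hle (energy_nonneg v)]
    have h4 : ((1 - 1 / k) * energy v + 2 / k * energy (v - w)) * energy v =
        energy v ^ 2 - (energy v ^ 2 - 2 * energy (v - w) * energy v) / k := by
      field_simp; ring
    rw [h4]; linarith
  rcases (energy_nonneg v).eq_or_lt with h0 | hpos
  · simpa [← h0] using key 0 (finrank_range_zero _)
  · have h1 : (∑ s, ‖v s‖ ^ 2 * energy (deflate v s) / energy v -
        (1 - 1 / k) * energy v) * (k / 2) ≤ tailEnergy k v := by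
      refine le_tailEnergy fun w hw => ?_
      have := key w hw
      rw [← div_le_iff₀ hpos, Finset.sum_div] at this
      rw [← le_div_iff₀ (by positivity)]
      refine (sub_le_iff_le_add'.2 this).trans (le_of_eq ?_)
      field_simp
    rw [← div_le_iff₀ hpos, Finset.sum_div]
    rw [← le_div_iff₀ (by positivity), sub_le_iff_le_add'] at h1
    refine h1.trans (le_of_eq ?_)
    field_simp

end Energy

/-! ## Randomly pivoted Nyström as random deflation of feature vectors -/

theorem samplePivot_of_eq_zero {n : ℕ} {p : Fin n → ℝ} (h : ∑' l, ENNReal.ofReal (p l) = 0) :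
    samplePivot p = RandT.lift ⟨none, n + 1⟩ :=
  dif_pos h

theorem samplePivot_of_ne_zero {n : ℕ} {p : Fin n → ℝ} (h : ∑' l, ENNReal.ofReal (p l) ≠ 0)
    (h' : ∑' l, ENNReal.ofReal (p l) ≠ ∞) :
    samplePivot p = (show RandT (Option (Fin n)) from
      PMF.map (fun s => (⟨some s, 3 * n + 2⟩ : Timed (Option (Fin n))))
        (PMF.normalize (fun l => ENNReal.ofReal (p l)) h h')) :=
  dif_neg h

theorem tsum_ofReal_ne_top {n : ℕ} (p : Fin n → ℝ) : ∑' l, ENNReal.ofReal (p l) ≠ ∞ := by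
  rw [tsum_fintype]
  exact ENNReal.sum_ne_top.2 fun _ _ => ENNReal.ofReal_ne_top

theorem outcomes_samplePivot {n : ℕ} {p : Fin n → ℝ} {ω : Timed (Option (Fin n))}
    (hω : ω ∈ (samplePivot p).outcomes) : ω.cost ≤ 3 * n + 2 ∧
      ((ω.val = none ∧ ∀ l, p l ≤ 0) ∨ ∃ s, ω.val = some s ∧ 0 < p s) := by
  by_cases h : ∑' l, ENNReal.ofReal (p l) = 0
  · rw [samplePivot_of_eq_zero h] at hω
    obtain rfl := RandT.mem_outcomes_lift.1 hω
    refine ⟨by simp only; omega, Or.inl ⟨rfl, fun l => ?_⟩⟩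
    exact ENNReal.ofReal_eq_zero.1 (ENNReal.tsum_eq_zero.1 h l)
  · rw [samplePivot_of_ne_zero h (tsum_ofReal_ne_top p)] at hω
    obtain ⟨s, hs, rfl⟩ := (PMF.mem_support_map_iff _ _ _).1 hω
    refine ⟨le_rfl, Or.inr ⟨s, rfl, ?_⟩⟩
    rw [PMF.mem_support_normalize_iff] at hs
    exact ENNReal.ofReal_pos.1 (pos_iff_ne_zero.2 hs)

theorem mean_samplePivot_none {n : ℕ} {p : Fin n → ℝ} (hp : ∀ l, p l = 0)
    (g : Option (Fin n) → ℝ≥0∞) : (samplePivot p).mean g = g none := by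
  rw [samplePivot_of_eq_zero (by simp [hp]), RandT.mean_lift]

theorem mean_samplePivot_some {n : ℕ} {p : Fin n → ℝ} (hp : ∀ l, 0 ≤ p l) (hsum : 0 < ∑ l, p l)
    (g : Option (Fin n) → ℝ≥0∞) :
    (samplePivot p).mean g = ∑ s, ENNReal.ofReal (p s / ∑ l, p l) * g (some s) := by
  have htot : ∑' l, ENNReal.ofReal (p l) = ENNReal.ofReal (∑ l, p l) := by
    rw [tsum_fintype, ENNReal.ofReal_sum_of_nonneg fun l _ => hp l]
  rw [samplePivot_of_ne_zero (by rw [htot]; exact (ENNReal.ofReal_pos.2 hsum).ne')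
    (tsum_ofReal_ne_top p)]
  refine (tsum_map_mul _ _ fun ω : Timed (Option (Fin n)) => g ω.val).trans ?_
  rw [tsum_fintype]
  refine Finset.sum_congr rfl fun s _ => ?_
  rw [PMF.normalize_apply, htot, ENNReal.ofReal_div_of_pos hsum, div_eq_mul_inv]

/-- The coefficients of the new direction in terms of the selected keys. -/
noncomputable def pivotCoeff {n d r : ℕ} (i : ℕ) (s : Fin n) (st : NysState n d r) : Fin r → ℝ :=
  fun a => if a.val < i then (∑ b, st.M a b * st.R b s) / Real.sqrt (st.p s)
    else if a.val = i then -1 / Real.sqrt (st.p s) else 0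

theorem nysUpdate_val {n d r : ℕ} (h : (Fin d → ℝ) → (Fin d → ℝ) → Timed ℝ)
    (K : Matrix (Fin n) (Fin d) ℝ) (i : ℕ) (s : Fin n) (st : NysState n d r) :
    (nysUpdate h K i s st).val =
      ⟨setRow st.KS i (K s),
        Matrix.of fun a b => st.M a b + pivotCoeff i s st a * pivotCoeff i s st b,
        setRow st.R i fun l => (h (K s) (K l)).val,
        fun l => if l = s then 0 else st.p l - (∑ a, pivotCoeff i s st a *
          setRow st.R i (fun l => (h (K s) (K l)).val) a l) ^ 2⟩ := by
  have hg : (fun a : Fin r => (if a.val < i then (do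
      let z ← dotT (st.M a) (fun b => st.R b s)
      divT z (Real.sqrt (st.p s)))
    else if a.val = i then divT (-1) (Real.sqrt (st.p s))
    else pure 0 : Timed ℝ).val) = pivotCoeff i s st := by
    funext a
    unfold pivotCoeff
    split_ifs <;> rfl
  rw [← hg]
  have hp : ∀ (l : Fin n) (x y : Timed ℝ), (if l = s then x else y).val =
      if l = s then x.val else y.val := fun l x y => by split_ifs <;> rfl
  simp only [sq]
  simp only [nysUpdate, Bind.bind, tabT, hp]
  rfl

section Features

variable {H : Type*} [NormedAddCommGroup H] [InnerProductSpace ℝ H]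
  {n d r : ℕ} (Φ : (Fin d → ℝ) → H) (K : Matrix (Fin n) (Fin d) ℝ)

/-- The features of the keys minus their Nyström approximation. -/
noncomputable def residual (st : NysState n d r) : Fin n → H := fun l =>
  Φ (K l) - ∑ a, (∑ b, st.M a b * st.R b l) • Φ (st.KS a)

/-- What holds after `i` rounds of the loop. -/
structure NysInvariant (i : ℕ) (st : NysState n d r) : Prop where
  diag : ∀ l, st.p l = ‖residual Φ K st l‖ ^ 2
  -- Residuals are orthogonal to the approximations, so the original kernel rows suffice to compute
  -- inner products of residuals.
  gram : ∀ l l', inner ℝ (residual Φ K st l) (Φ (K l')) =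
    inner ℝ (residual Φ K st l) (residual Φ K st l')
  keys : ∀ a, st.KS a = 0 ∨ ∃ l, st.KS a = K l
  -- The guard covers early stopping: once `p` vanishes, `i` still advances but no row is filled, so
  -- `rows` could fail; no later update needs it.
  support : (∃ l, st.p l ≠ 0) → ∀ a b, (i ≤ a.val ∨ i ≤ b.val) → st.M a b = 0
  rows : (∃ l, st.p l ≠ 0) → ∀ a l, a.val < i → st.R a l = inner ℝ (Φ (st.KS a)) (Φ (K l))

variable {Φ K} {h : (Fin d → ℝ) → (Fin d → ℝ) → Timed ℝ}

theorem setRow_self {r k : ℕ} (A : Matrix (Fin r) (Fin k) ℝ) (a : Fin r) {i : ℕ} (ha : a.val = i)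
    (v : Fin k → ℝ) : setRow A i v a = v := by
  funext b; simp [setRow, ha]

theorem setRow_ne {r k : ℕ} (A : Matrix (Fin r) (Fin k) ℝ) {a : Fin r} {i : ℕ} (ha : a.val ≠ i)
    (v : Fin k → ℝ) : setRow A i v a = A a := by
  funext b; simp [setRow, ha]

/-- The vector `g` makes `∑ a, g a • Φ (KS a)` minus the normalised residual of the pivot. Adding `g
gᵀ` to `M` therefore subtracts from each residual its projection onto the pivot's residual. -/
theorem NysInvariant.update (hΦ : ∀ x y, (h x y).val = inner ℝ (Φ x) (Φ y)) {i : ℕ} (hi : i < r)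
    {st : NysState n d r} (inv : NysInvariant Φ K i st) {s : Fin n} (hs : 0 < st.p s) :
    residual Φ K (nysUpdate h K i s st).val = deflate (residual Φ K st) s ∧
      NysInvariant Φ K (i + 1) (nysUpdate h K i s st).val := by
  have hp : ∃ l, st.p l ≠ 0 := ⟨s, hs.ne'⟩
  have hM := inv.support hp
  have hR := inv.rows hp
  set v := residual Φ K st with hv
  set g := pivotCoeff i s st with hg
  set st' := (nysUpdate h K i s st).val with hst'
  have hval := nysUpdate_val h K i s st
  rw [← hst', ← hg] at hval
  have hKS : st'.KS = setRow st.KS i (K s) := by rw [hval]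
  have hM' : ∀ a b, st'.M a b = st.M a b + g a * g b := fun a b => by rw [hval]; rfl
  have hR' : st'.R = setRow st.R i fun l => (h (K s) (K l)).val := by rw [hval]
  have hp' : ∀ l, st'.p l = if l = s then 0 else st.p l - (∑ a, g a * st'.R a l) ^ 2 := fun l => by
    rw [hR', hval]
  have hsq : Real.sqrt (st.p s) ^ 2 = ‖v s‖ ^ 2 := by rw [Real.sq_sqrt hs.le, inv.diag]
  have hroot : 0 < Real.sqrt (st.p s) := Real.sqrt_pos.2 hs
  set q := Real.sqrt (st.p s) with hq
  have hg0 : ∀ a : Fin r, i < a.val → g a = 0 := fun a ha => by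
    simp only [hg, pivotCoeff]
    rw [if_neg (by omega), if_neg (by omega)]
  have hrow : ∀ (a : Fin r) l, a.val < i + 1 →
      st'.R a l = inner ℝ (Φ (st'.KS a)) (Φ (K l)) := by
    intro a l ha
    rw [hR', hKS]
    by_cases hai : a.val = i
    · rw [setRow_self _ a hai, setRow_self _ a hai, hΦ]
    · rw [setRow_ne _ hai, setRow_ne _ hai, hR a l (by omega)]
  have hdir : ∑ a, g a • Φ (st'.KS a) = -(1 / q) • v s := by
    have hterm : ∀ a : Fin r, g a • Φ (st'.KS a) = -(1 / q) •
        ((if a = (⟨i, hi⟩ : Fin r) then Φ (K s) else 0) -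
          (∑ b, st.M a b * st.R b s) • Φ (st.KS a)) := by
      intro a
      rw [hKS]
      rcases lt_trichotomy a.val i with ha | ha | ha
      · have hne : a ≠ ⟨i, hi⟩ := fun h => by rw [h] at ha; exact lt_irrefl _ ha
        rw [setRow_ne _ ha.ne, if_neg hne]
        simp only [hg, pivotCoeff, if_pos ha, ← hq]
        module
      · have heq : a = ⟨i, hi⟩ := Fin.ext ha
        rw [setRow_self _ a ha, if_pos heq,
          Finset.sum_eq_zero fun b _ => by rw [hM a b (Or.inl ha.ge), zero_mul]]
        simp only [hg, pivotCoeff, if_neg (lt_irrefl i), ha, if_true, zero_smul, sub_zero, ← hq]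
        congr 1
        ring
      · have hne : a ≠ ⟨i, hi⟩ := fun h => by rw [h] at ha; exact lt_irrefl _ ha
        rw [hg0 a ha, if_neg hne,
          Finset.sum_eq_zero fun b _ => by rw [hM a b (Or.inl ha.le), zero_mul]]
        simp
    rw [Finset.sum_congr rfl fun a _ => hterm a, ← Finset.smul_sum, Finset.sum_sub_distrib,
      Finset.sum_ite_eq' Finset.univ, if_pos (Finset.mem_univ _)]
    rfl
  have hdelta : ∀ l, ∑ a, g a * st'.R a l = -(1 / q) * inner ℝ (v s) (v l) := by
    intro l
    have h1 : ∀ a, g a * st'.R a l = inner ℝ (g a • Φ (st'.KS a)) (Φ (K l)) := by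
      intro a
      rw [real_inner_smul_left]
      by_cases ha : a.val < i + 1
      · rw [hrow a l ha]
      · rw [hg0 a (by omega), zero_mul, zero_mul]
    rw [Finset.sum_congr rfl fun a _ => h1 a, ← sum_inner, hdir, real_inner_smul_left, inv.gram]
  -- The overwritten row of `R` and the new key meet only zero entries of the old `M`.
  have hW : ∀ l, ∑ a, (∑ b, st.M a b * st'.R b l) • Φ (st'.KS a) =
      ∑ a, (∑ b, st.M a b * st.R b l) • Φ (st.KS a) := by
    intro l
    refine Finset.sum_congr rfl fun a _ => ?_
    by_cases ha : i ≤ a.val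
    · rw [Finset.sum_eq_zero fun b _ => by rw [hM a b (Or.inl ha), zero_mul],
        Finset.sum_eq_zero fun b _ => by rw [hM a b (Or.inl ha), zero_mul], zero_smul, zero_smul]
    · rw [hKS, setRow_ne _ (by omega)]
      congr 1
      refine Finset.sum_congr rfl fun b _ => ?_
      by_cases hb : i ≤ b.val
      · rw [hM a b (Or.inr hb), zero_mul, zero_mul]
      · rw [hR', setRow_ne _ (by omega)]
  have hres : residual Φ K st' = deflate v s := by
    funext l
    have h1 : ∑ a, (∑ b, st'.M a b * st'.R b l) • Φ (st'.KS a) =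
        ∑ a, (∑ b, st.M a b * st.R b l) • Φ (st.KS a) +
          (∑ b, g b * st'.R b l) • ∑ a, g a • Φ (st'.KS a) := by
      rw [← hW, Finset.smul_sum, ← Finset.sum_add_distrib]
      refine Finset.sum_congr rfl fun a _ => ?_
      rw [smul_smul, ← add_smul, Finset.sum_mul, ← Finset.sum_add_distrib]
      congr 1
      refine Finset.sum_congr rfl fun b _ => ?_
      rw [hM']; ring
    rw [residual, h1, ← sub_sub, hdelta, hdir, smul_smul, deflate, reject_apply, ← hsq]
    change v l - _ = _
    congr 2
    field_simp
  refine ⟨hres, ⟨fun l => ?_, fun l l' => ?_, fun a => ?_, fun _ a b hab => ?_, fun _ a l ha => ?_⟩⟩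
  · rw [hres, hp']
    split_ifs with hl
    · simp [hl, deflate, reject_self]
    · rw [deflate, norm_reject_sq, hdelta, inv.diag, ← hsq]
      congr 1
      field_simp
  · rw [hres, deflate, deflate, inner_reject_reject, inner_reject_left, inv.gram, inv.gram]
  · rw [hKS]
    by_cases ha : a.val = i
    · rw [setRow_self _ a ha]; exact Or.inr ⟨s, rfl⟩
    · rw [setRow_ne _ ha]; exact inv.keys a
  · rw [hM', hM a b (by omega)]
    rcases hab with hab | hab
    · rw [hg0 a (by omega)]; ring
    · rw [hg0 b (by omega)]; ring
  · exact hrow a l ha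

theorem NysInvariant.init (hΦ : ∀ x y, (h x y).val = inner ℝ (Φ x) (Φ y)) :
    NysInvariant Φ K 0 (⟨0, 0, 0, fun l => (h (K l) (K l)).val⟩ : NysState n d r) := by
  have hres : residual Φ K (⟨0, 0, 0, fun l => (h (K l) (K l)).val⟩ : NysState n d r) =
      fun l => Φ (K l) := by
    funext l; simp [residual]
  refine ⟨fun l => ?_, fun l l' => ?_, fun a => Or.inl rfl, fun _ a b _ => rfl,
    fun _ a l ha => absurd ha (Nat.not_lt_zero _)⟩
  · rw [hres, ← real_inner_self_eq_norm_sq, ← hΦ]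
  · rw [hres]

theorem residual_init (p : Fin n → ℝ) :
    residual Φ K (⟨0, 0, 0, p⟩ : NysState n d r) = fun l => Φ (K l) := by
  funext l; simp [residual]

theorem NysInvariant.round (hΦ : ∀ x y, (h x y).val = inner ℝ (Φ x) (Φ y)) {i : ℕ} (hi : i < r)
    {st : NysState n d r} (inv : NysInvariant Φ K i st) {ω : Timed (NysState n d r)}
    (hω : ω ∈ (nysRound h K i st).outcomes) :
    NysInvariant Φ K (i + 1) ω.val ∧
      (ω.val = st ∨ ∃ s, residual Φ K ω.val = deflate (residual Φ K st) s) := by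
  rw [nysRound, RandT.mem_outcomes_bind] at hω
  obtain ⟨a, ha, b, hb, rfl⟩ := hω
  rcases (outcomes_samplePivot ha).2 with ⟨hn, h0⟩ | ⟨s, hs, hpos⟩
  · rw [hn] at hb
    rw [RandT.mem_outcomes_pure.1 hb]
    have hp : ∀ l, st.p l = 0 := fun l => le_antisymm (h0 l) (by rw [inv.diag]; positivity)
    exact ⟨⟨inv.diag, inv.gram, inv.keys, fun ⟨l, hl⟩ => absurd (hp l) hl,
      fun ⟨l, hl⟩ => absurd (hp l) hl⟩, Or.inl rfl⟩
  · rw [hs] at hb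
    rw [RandT.mem_outcomes_lift.1 hb]
    obtain ⟨h1, h2⟩ := inv.update hΦ hi hpos
    exact ⟨h2, Or.inr ⟨s, h1⟩⟩

theorem NysInvariant.loop (hΦ : ∀ x y, (h x y).val = inner ℝ (Φ x) (Φ y))
    {st : NysState n d r} (inv : NysInvariant Φ K 0 st) (j : ℕ) {i : ℕ} (hi : i ≤ r)
    {ω : Timed (NysState n d r)} (hω : ω ∈ (nysLoop h K st i).outcomes) :
    NysInvariant Φ K i ω.val ∧
      tailEnergy j (residual Φ K ω.val) ≤ tailEnergy j (residual Φ K st) := by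
  induction i generalizing ω with
  | zero =>
    rw [nysLoop] at hω
    rw [RandT.mem_outcomes_pure.1 hω]
    exact ⟨inv, le_rfl⟩
  | succ i ih =>
    rw [nysLoop, RandT.mem_outcomes_bind] at hω
    obtain ⟨a, ha, b, hb, rfl⟩ := hω
    obtain ⟨h1, h2⟩ := ih (by omega) ha
    obtain ⟨h3, h4⟩ := h1.round hΦ (by omega) hb
    refine ⟨h3, ?_⟩
    rcases h4 with h4 | ⟨s, h4⟩
    · rw [h4]; exact h2
    · rw [h4]; exact (tailEnergy_deflate_le j _ s).trans h2

/-- Sampling probabilities are ‖v s‖² / energy, so a weighted sum over pivots becomes an expectation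
over the round. The hypothesis `h0` covers the round in which nothing remains to be sampled. -/
theorem mean_nysRound_le (hΦ : ∀ x y, (h x y).val = inner ℝ (Φ x) (Φ y)) {i : ℕ} (hi : i < r)
    {st : NysState n d r} (inv : NysInvariant Φ K i st) {ψ : (Fin n → H) → ℝ} (hψ : ∀ v, 0 ≤ ψ v)
    {c : ℝ} (hc : ∑ s, ‖residual Φ K st s‖ ^ 2 * ψ (deflate (residual Φ K st) s) ≤
      c * energy (residual Φ K st))
    (h0 : energy (residual Φ K st) = 0 → ψ (residual Φ K st) ≤ c) :
    (nysRound h K i st).mean (fun st' => ENNReal.ofReal (ψ (residual Φ K st'))) ≤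
      ENNReal.ofReal c := by
  set v := residual Φ K st with hv
  have hsum : ∑ l, st.p l = energy v := Finset.sum_congr rfl fun l _ => inv.diag l
  have hpn : ∀ l, 0 ≤ st.p l := fun l => by rw [inv.diag]; positivity
  rw [nysRound, RandT.mean_bind]
  rcases (energy_nonneg v).eq_or_lt with hz | hpos
  · have hv0 := energy_eq_zero.1 hz.symm
    rw [mean_samplePivot_none (fun l => by rw [inv.diag, ← hv, hv0]; simp)]
    rw [RandT.mean_pure]
    exact ENNReal.ofReal_le_ofReal (h0 hz.symm)
  · rw [mean_samplePivot_some hpn (by rw [hsum]; exact hpos), hsum]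
    have hterm : ∀ s, ENNReal.ofReal (st.p s / energy v) *
        (RandT.lift (nysUpdate h K i s st)).mean
          (fun st' => ENNReal.ofReal (ψ (residual Φ K st'))) =
        ENNReal.ofReal (‖v s‖ ^ 2 * ψ (deflate v s) / energy v) := by
      intro s
      rcases (hpn s).eq_or_lt with hs | hs
      · rw [← hs, zero_div, ENNReal.ofReal_zero, zero_mul, ← inv.diag, ← hs]
        simp
      · rw [RandT.mean_lift, (inv.update hΦ hi hs).1, ← ENNReal.ofReal_mul (by positivity),
          inv.diag]
        congr 1
        ring
    refine (Finset.sum_congr rfl fun s _ => hterm s).trans_le ?_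
    rw [← ENNReal.ofReal_sum_of_nonneg fun s _ =>
      div_nonneg (mul_nonneg (sq_nonneg _) (hψ _)) hpos.le, ← Finset.sum_div]
    exact ENNReal.ofReal_le_ofReal ((div_le_iff₀ hpos).2 hc)

/-- Each round trades one unit of rank for a factor 6; at `i = k` the rank-0 tail is the energy
itself. -/
theorem mean_nysLoop_tailEnergy_le (hΦ : ∀ x y, (h x y).val = inner ℝ (Φ x) (Φ y))
    {st : NysState n d r} (inv : NysInvariant Φ K 0 st) {k : ℕ} (i : ℕ) (hik : i ≤ k)
    (hi : i ≤ r) :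
    (nysLoop h K st i).mean (fun st' => ENNReal.ofReal (tailEnergy (k - i) (residual Φ K st'))) ≤
      ENNReal.ofReal (6 ^ i * tailEnergy k (residual Φ K st)) := by
  induction i with
  | zero => rw [nysLoop, RandT.mean_pure]; simp
  | succ i ih =>
    rw [nysLoop, RandT.mean_bind]
    have hstep : ∀ ω ∈ (nysLoop h K st i).outcomes,
        (nysRound h K i ω.val).mean
          (fun st' => ENNReal.ofReal (tailEnergy (k - (i + 1)) (residual Φ K st'))) ≤
        ENNReal.ofReal 6 * ENNReal.ofReal (tailEnergy (k - i) (residual Φ K ω.val)) := by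
      intro ω hω
      have hki : k - i = k - (i + 1) + 1 := by omega
      rw [← ENNReal.ofReal_mul (by norm_num)]
      refine mean_nysRound_le hΦ (by omega) (inv.loop hΦ 0 (by omega) hω).1
        (tailEnergy_nonneg (k - (i + 1))) ?_ fun h0 => ?_
      · rw [hki]; exact sum_mul_tailEnergy_deflate_le _ _
      · exact ((tailEnergy_le_energy _ _).trans h0.le).trans
          (mul_nonneg (by norm_num) (tailEnergy_nonneg _ _))
    refine (RandT.mean_mono (g := fun st' => ENNReal.ofReal 6 *
      ENNReal.ofReal (tailEnergy (k - i) (residual Φ K st'))) hstep).trans ?_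
    rw [RandT.mean_const_mul, pow_succ', mul_assoc, ENNReal.ofReal_mul (by norm_num)]
    gcongr
    exact ih (by omega) (by omega)

/-- After `k` rounds the energy is at most 6^k δ on average; the next `m` rounds iterate x ↦ (1 -
1/k) x + (2/k) δ, whose fixed point is 2δ. -/
theorem mean_nysLoop_energy_le (hΦ : ∀ x y, (h x y).val = inner ℝ (Φ x) (Φ y))
    {st : NysState n d r} (inv : NysInvariant Φ K 0 st) {k : ℕ} (hk : 1 ≤ k) (m : ℕ)
    (hm : k + m ≤ r) :
    (nysLoop h K st (k + m)).mean (fun st' => ENNReal.ofReal (energy (residual Φ K st'))) ≤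
      ENNReal.ofReal ((2 + (1 - 1 / k) ^ m * 6 ^ k) * tailEnergy k (residual Φ K st)) := by
  set δ := tailEnergy k (residual Φ K st) with hδ
  have hδ0 : 0 ≤ δ := tailEnergy_nonneg _ _
  have hk0 : (0 : ℝ) < k := by exact_mod_cast hk
  have hk1 : (0 : ℝ) ≤ 1 - 1 / k := by
    rw [sub_nonneg, div_le_one hk0]; exact_mod_cast hk
  induction m with
  | zero =>
    have := mean_nysLoop_tailEnergy_le hΦ inv k le_rfl (by omega)
    simp only [Nat.sub_self, tailEnergy_zero] at this
    refine this.trans (ENNReal.ofReal_le_ofReal ?_)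
    rw [pow_zero, one_mul]
    nlinarith
  | succ m ih =>
    rw [← add_assoc, nysLoop, RandT.mean_bind]
    have hstep : ∀ ω ∈ (nysLoop h K st (k + m)).outcomes,
        (nysRound h K (k + m) ω.val).mean
          (fun st' => ENNReal.ofReal (energy (residual Φ K st'))) ≤
        ENNReal.ofReal (1 - 1 / k) * ENNReal.ofReal (energy (residual Φ K ω.val)) +
          ENNReal.ofReal (2 / k * δ) := by
      intro ω hω
      obtain ⟨h1, h2⟩ := inv.loop hΦ k (by omega) hω
      rw [← ENNReal.ofReal_mul hk1, ← ENNReal.ofReal_add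
        (mul_nonneg hk1 (energy_nonneg _)) (by positivity)]
      refine mean_nysRound_le hΦ (by omega) h1 energy_nonneg ?_ fun h0 => ?_
      · refine (sum_mul_energy_deflate_le hk _).trans ?_
        have := energy_nonneg (residual Φ K ω.val)
        gcongr
      · rw [h0]; positivity
    refine (RandT.mean_mono (g := fun st' => ENNReal.ofReal (1 - 1 / k) *
      ENNReal.ofReal (energy (residual Φ K st')) + ENNReal.ofReal (2 / k * δ)) hstep).trans ?_
    rw [RandT.mean_add, RandT.mean_const_mul, RandT.mean_const]
    calc _ ≤ ENNReal.ofReal (1 - 1 / k) *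
            ENNReal.ofReal ((2 + (1 - 1 / k) ^ m * 6 ^ k) * δ) + ENNReal.ofReal (2 / k * δ) := by
          gcongr
          exact ih (by omega)
      _ = _ := by
          rw [← ENNReal.ofReal_mul hk1, ← ENNReal.ofReal_add (by positivity) (by positivity)]
          congr 1
          ring

/-- With `r ≥ 3 k²` rounds the expected residual energy is at most three times the rank-`k`
tail. -/
theorem mean_nysLoop_energy_le_three_mul (hΦ : ∀ x y, (h x y).val = inner ℝ (Φ x) (Φ y))
    {st : NysState n d r} (inv : NysInvariant Φ K 0 st) {k : ℕ} (hk : 1 ≤ k)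
    (hr : 3 * k ^ 2 ≤ r) :
    (nysLoop h K st r).mean (fun st' => ENNReal.ofReal (energy (residual Φ K st'))) ≤
      ENNReal.ofReal (3 * tailEnergy k (residual Φ K st)) := by
  have hk0 : (0 : ℝ) < k := by exact_mod_cast hk
  have hk1 : (0 : ℝ) ≤ 1 - 1 / k := by
    rw [sub_nonneg, div_le_one hk0]; exact_mod_cast hk
  have hkk : k ≤ k ^ 2 := Nat.le_self_pow two_ne_zero k
  obtain ⟨m, rfl⟩ : ∃ m, r = k + m := ⟨r - k, by omega⟩
  refine (mean_nysLoop_energy_le hΦ inv hk m le_rfl).trans (ENNReal.ofReal_le_ofReal ?_)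
  have hmk : 2 * k ^ 2 ≤ m := by omega
  have h1 : (1 - 1 / k : ℝ) ≤ Real.exp (-(1 / k)) := by
    have := Real.add_one_le_exp (-(1 / k : ℝ)); linarith
  -- With m ≥ 2k² the power is at most e^{-2k}, and 6 ≤ e².
  have h2 : (1 - 1 / k : ℝ) ^ m * 6 ^ k ≤ 1 := by
    have h6 : (6 : ℝ) ≤ Real.exp 2 := by
      have := Real.exp_one_gt_d9
      rw [show (2 : ℝ) = 1 + 1 by norm_num, Real.exp_add]
      nlinarith
    calc (1 - 1 / k : ℝ) ^ m * 6 ^ k ≤ Real.exp (-(1 / k)) ^ m * Real.exp 2 ^ k := by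
          gcongr
      _ = Real.exp (-(m / k) + 2 * k) := by
          rw [← Real.exp_nat_mul, ← Real.exp_nat_mul, ← Real.exp_add]
          congr 1; ring
      _ ≤ 1 := by
          rw [Real.exp_le_one_iff, neg_add_le_iff_le_add, add_zero, le_div_iff₀ hk0]
          have : ((2 * k ^ 2 : ℕ) : ℝ) ≤ m := by exact_mod_cast hmk
          push_cast at this
          linarith
  nlinarith [tailEnergy_nonneg k (residual Φ K st)]

end Features

/-! ## Features of the exponential kernel -/

theorem hasSum_mul_of_summable_norm {ι κ : Type*} {f : ι → ℝ} {g : κ → ℝ} {x y : ℝ}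
    (hf : Summable fun i => ‖f i‖) (hg : Summable fun i => ‖g i‖) (hfx : HasSum f x)
    (hgy : HasSum g y) : HasSum (fun z : ι × κ => f z.1 * g z.2) (x * y) :=
  hfx.mul hgy (summable_mul_of_summable_norm hf hg)

theorem hasSum_prod_pi {d : ℕ} (f : Fin d → ℕ → ℝ) (hf : ∀ j, Summable fun a => ‖f j a‖) :
    (Summable fun α : Fin d → ℕ => ‖∏ j, f j (α j)‖) ∧
      HasSum (fun α : Fin d → ℕ => ∏ j, f j (α j)) (∏ j, ∑' a, f j a) := by
  induction d with
  | zero =>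
    simp only [Finset.univ_eq_empty, Finset.prod_empty]
    exact ⟨(hasSum_fintype _).summable, by simp⟩
  | succ d ih =>
    obtain ⟨G, hG⟩ : ∃ G : (Fin d → ℕ) → ℝ, ∀ α, ∏ j, f j.succ (α j) = G α := ⟨_, fun _ => rfl⟩
    obtain ⟨h1, h2⟩ := ih (fun j => f j.succ) fun j => hf j.succ
    simp only [hG] at h1 h2
    let e : ℕ × (Fin d → ℕ) ≃ (Fin (d + 1) → ℕ) := Fin.consEquiv fun _ => ℕ
    have he : (fun α : Fin (d + 1) → ℕ => ∏ j, f j (α j)) ∘ e = fun z => f 0 z.1 * G z.2 := by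
      funext z
      rw [← hG, Function.comp, Fin.prod_univ_succ]
      rfl
    have he' : (fun α : Fin (d + 1) → ℕ => ‖∏ j, f j (α j)‖) ∘ e =
        fun z => ‖f 0 z.1 * G z.2‖ := by
      rw [← Function.comp_def norm, Function.comp_assoc, he]
      rfl
    rw [← e.summable_iff, ← e.hasSum_iff, Fin.prod_univ_succ, he, he']
    exact ⟨(hf 0).mul_norm h1, hasSum_mul_of_summable_norm (hf 0) h1 (hf 0).of_norm.hasSum h2⟩

theorem hasSum_pow_div_factorial (x : ℝ) :
    HasSum (fun a : ℕ => x ^ a / a.factorial) (Real.exp x) := by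
  rw [Real.exp_eq_exp_ℝ]
  exact NormedSpace.expSeries_div_hasSum_exp x

/-- Since (a + s)! ≥ a! s!, the remainder is dominated termwise. The bound is relative to exp y, the
form that multiplies well over coordinates. -/
theorem exp_sub_sum_le {y : ℝ} (hy : 0 ≤ y) (s : ℕ) :
    Real.exp y - ∑ a ∈ Finset.range s, y ^ a / a.factorial ≤
      y ^ s / s.factorial * Real.exp y := by
  have h := hasSum_pow_div_factorial y
  have h1 := (hasSum_nat_add_iff' s).2 h
  refine hasSum_le (fun a => ?_) h1 (h.mul_left (y ^ s / s.factorial))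
  rw [div_mul_div_comm, ← pow_add, add_comm s a]
  have : ((s.factorial * a.factorial : ℕ) : ℝ) ≤ ((a + s).factorial : ℕ) := by
    rw [mul_comm]
    exact_mod_cast Nat.le_of_dvd (Nat.factorial_pos _) (Nat.factorial_mul_factorial_dvd_factorial_add a s)
  push_cast at this
  gcongr

/-- Replacing the factors one at a time, relative errors add up. -/
theorem prod_sub_prod_le {ι : Type*} (S : Finset ι) {E T : ι → ℝ} {c : ℝ} (hT : ∀ j, 0 ≤ T j)
    (hTE : ∀ j, T j ≤ E j) (hc : 0 ≤ c) (h : ∀ j, E j - T j ≤ c * E j) :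
    ∏ j ∈ S, E j - ∏ j ∈ S, T j ≤ S.card * c * ∏ j ∈ S, E j := by
  classical
  induction S using Finset.induction_on with
  | empty => simp
  | insert a S ha ih =>
    rw [Finset.prod_insert ha, Finset.prod_insert ha, Finset.card_insert_of_notMem ha]
    have hP : 0 ≤ ∏ j ∈ S, E j := Finset.prod_nonneg fun j _ => (hT j).trans (hTE j)
    have h1 := mul_le_mul_of_nonneg_right (h a) hP
    have h2 := mul_le_mul_of_nonneg_left ih (hT a)
    have h3 := mul_le_mul_of_nonneg_right (hTE a)
      (mul_nonneg (mul_nonneg (Nat.cast_nonneg S.card) hc) hP)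
    push_cast
    nlinarith

/-- The coordinates of the feature vector of the kernel `exp ⟨x, y⟩`. -/
noncomputable def expCoord {d : ℕ} (x : Fin d → ℝ) (α : Fin d → ℕ) : ℝ :=
  ∏ j, x j ^ α j / Real.sqrt (α j).factorial

theorem expCoord_mul {d : ℕ} (x y : Fin d → ℝ) (α : Fin d → ℕ) :
    expCoord x α * expCoord y α = ∏ j, (x j * y j) ^ α j / (α j).factorial := by
  rw [expCoord, expCoord, ← Finset.prod_mul_distrib]
  refine Finset.prod_congr rfl fun j _ => ?_
  rw [div_mul_div_comm, Real.mul_self_sqrt (by positivity), mul_pow]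

theorem hasSum_expCoord_mul {d : ℕ} (x y : Fin d → ℝ) :
    HasSum (fun α => expCoord x α * expCoord y α) (Real.exp (x ⬝ᵥ y)) := by
  simp_rw [expCoord_mul, dotProduct, Real.exp_sum]
  have h := (hasSum_prod_pi (fun j a => (x j * y j) ^ a / (a.factorial : ℝ)) fun j => by
    simp_rw [norm_div, norm_pow, Real.norm_natCast]
    exact (hasSum_pow_div_factorial _).summable).2
  simpa only [(hasSum_pow_div_factorial _).tsum_eq] using h

/-- The feature vector of the kernel `exp ⟨x, y⟩`. -/
noncomputable def expFeature {d : ℕ} (x : Fin d → ℝ) : lp (fun _ : Fin d → ℕ => ℝ) 2 :=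
  ⟨expCoord x, memℓp_gen (by
    refine (hasSum_expCoord_mul x x).summable.congr fun α => ?_
    simp [sq])⟩

theorem inner_expFeature {d : ℕ} (x y : Fin d → ℝ) :
    inner ℝ (expFeature x) (expFeature y) = Real.exp (x ⬝ᵥ y) := by
  rw [lp.inner_eq_tsum, ← (hasSum_expCoord_mul x y).tsum_eq]
  refine tsum_congr fun α => ?_
  simp [expFeature, mul_comm]

/-- The part of the feature vector with all exponents below `s`. -/
noncomputable def truncFeature {d : ℕ} (s : ℕ) (x : Fin d → ℝ) :
    lp (fun _ : Fin d → ℕ => ℝ) 2 :=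
  ∑ α ∈ Fintype.piFinset fun _ => Finset.range s, lp.single 2 α (expCoord x α)

/-- Truncation is a coordinate projection, so the squared distance is a difference of squared norms;
restricting exponents to a cube makes both norms products over coordinates. -/
theorem norm_expFeature_sub_truncFeature_sq {d : ℕ} (s : ℕ) (x : Fin d → ℝ) :
    ‖expFeature x - truncFeature s x‖ ^ 2 =
      ∏ j, Real.exp (x j ^ 2) - ∏ j, ∑ a ∈ Finset.range s, (x j ^ 2) ^ a / a.factorial := by
  have h1 : inner ℝ (expFeature x) (truncFeature s x) =
      ∑ α ∈ Fintype.piFinset fun _ => Finset.range s, expCoord x α * expCoord x α := by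
    rw [truncFeature, inner_sum]
    refine Finset.sum_congr rfl fun α _ => ?_
    rw [lp.inner_single_right]
    simp [expFeature, sq]
  have h2 : ‖truncFeature s x‖ ^ 2 =
      ∑ α ∈ Fintype.piFinset fun _ => Finset.range s, expCoord x α * expCoord x α := by
    have := lp.norm_sum_single (E := fun _ : Fin d → ℕ => ℝ) (p := 2) (by norm_num)
      (expCoord x) (Fintype.piFinset fun _ => Finset.range s)
    simpa [← sq, truncFeature] using this
  have h3 : ‖expFeature x‖ ^ 2 = ∏ j, Real.exp (x j ^ 2) := by
    rw [← real_inner_self_eq_norm_sq, inner_expFeature, dotProduct, Real.exp_sum]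
    simp_rw [sq]
  rw [norm_sub_sq_real, h1, h2, h3, Finset.prod_univ_sum]
  simp_rw [expCoord_mul, ← sq]
  ring

theorem finrank_range_truncFeature_le {ι : Type*} [Fintype ι] {d : ℕ} (s : ℕ)
    (x : ι → Fin d → ℝ) :
    Set.finrank ℝ (Set.range fun l => truncFeature s (x l)) ≤ s ^ d := by
  classical
  let B : Finset (lp (fun _ : Fin d → ℕ => ℝ) 2) :=
    (Fintype.piFinset fun _ => Finset.range s).image fun α => lp.single 2 α (1 : ℝ)
  have hB : B.card ≤ s ^ d := Finset.card_image_le.trans (by simp)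
  have : FiniteDimensional ℝ (Submodule.span ℝ (B : Set (lp (fun _ : Fin d → ℕ => ℝ) 2))) :=
    FiniteDimensional.span_finset ℝ B
  refine (finrank_range_le_of_mem fun l => ?_).trans ((finrank_span_finset_le_card B).trans hB)
  refine Submodule.sum_mem _ fun α hα => ?_
  have h : lp.single (E := fun _ : Fin d → ℕ => ℝ) 2 α (expCoord (x l) α) =
      expCoord (x l) α • lp.single (E := fun _ : Fin d → ℕ => ℝ) 2 α (1 : ℝ) := by
    rw [← lp.single_smul, smul_eq_mul, mul_one]
  rw [h]
  exact Submodule.smul_mem _ _ (Submodule.subset_span (by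
    simpa [B] using ⟨α, by simpa using hα, rfl⟩))

theorem tailEnergy_expFeature_le {ι : Type*} [Fintype ι] {d : ℕ} (s : ℕ) (x : ι → Fin d → ℝ)
    {L : ℝ} (hx : ∀ l, x l ⬝ᵥ x l ≤ L) (hL : 0 ≤ L) :
    tailEnergy (s ^ d) (fun l => expFeature (x l)) ≤
      Fintype.card ι * (d * (L ^ s / s.factorial) * Real.exp L) := by
  refine (tailEnergy_le _ _ (finrank_range_truncFeature_le s x)).trans ?_
  have hl : ∀ l, ‖expFeature (x l) - truncFeature s (x l)‖ ^ 2 ≤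
      d * (L ^ s / s.factorial) * Real.exp L := by
    intro l
    have hsq : ∀ j, x l j ^ 2 ≤ L := fun j => by
      refine le_trans ?_ (hx l)
      rw [sq]
      exact Finset.single_le_sum (f := fun j => x l j * x l j) (fun _ _ => mul_self_nonneg _)
        (Finset.mem_univ j)
    rw [norm_expFeature_sub_truncFeature_sq]
    refine (prod_sub_prod_le Finset.univ (c := L ^ s / s.factorial) (fun j => ?_) (fun j => ?_)
      (by positivity) (fun j => ?_)).trans ?_
    · exact Finset.sum_nonneg fun _ _ => by positivity
    · exact Real.sum_le_exp_of_nonneg (sq_nonneg _) s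
    · refine (exp_sub_sum_le (sq_nonneg _) s).trans ?_
      gcongr
      exact hsq j
    · rw [Finset.card_fin, ← Real.exp_sum]
      gcongr
      refine le_trans (le_of_eq ?_) (hx l)
      exact Finset.sum_congr rfl fun j _ => sq _
  calc energy ((fun l => expFeature (x l)) - fun l => truncFeature s (x l))
      ≤ ∑ _l : ι, (d * (L ^ s / s.factorial) * Real.exp L) := Finset.sum_le_sum fun l _ => hl l
    _ = _ := by rw [Finset.sum_const, Finset.card_univ, nsmul_eq_mul]

/-! ## Norms -/

theorem abs_le_maxNorm {m n : ℕ} (A : Matrix (Fin m) (Fin n) ℝ) (i : Fin m) (j : Fin n) :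
    |A i j| ≤ maxNorm A :=
  (le_ciSup (f := fun j => |A i j|) (Set.finite_range _).bddAbove j).trans
    (le_ciSup (f := fun i => ⨆ j, |A i j|) (Set.finite_range _).bddAbove i)

theorem maxNorm_nonneg {m n : ℕ} (A : Matrix (Fin m) (Fin n) ℝ) : 0 ≤ maxNorm A :=
  Real.iSup_nonneg fun _ => Real.iSup_nonneg fun _ => abs_nonneg _

theorem maxNorm_le {m n : ℕ} {A : Matrix (Fin m) (Fin n) ℝ} {c : ℝ} (hc : 0 ≤ c)
    (h : ∀ i j, |A i j| ≤ c) : maxNorm A ≤ c :=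
  Real.iSup_le (fun i => Real.iSup_le (h i) hc) hc

theorem rowNorm_nonneg {m n : ℕ} (A : Matrix (Fin m) (Fin n) ℝ) : 0 ≤ rowNorm A :=
  Real.iSup_nonneg fun _ => Real.sqrt_nonneg _

theorem sqrt_dotProduct_self_le_rowNorm {m n : ℕ} (A : Matrix (Fin m) (Fin n) ℝ) (i : Fin m) :
    Real.sqrt (A i ⬝ᵥ A i) ≤ rowNorm A := by
  refine le_trans (le_of_eq ?_)
    (le_ciSup (f := fun i => Real.sqrt (∑ j, A i j ^ 2)) (Set.finite_range _).bddAbove i)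
  simp_rw [dotProduct, sq]

theorem dotProduct_self_nonneg' {k : ℕ} (x : Fin k → ℝ) : 0 ≤ x ⬝ᵥ x :=
  Finset.sum_nonneg fun _ _ => mul_self_nonneg _

theorem dotProduct_self_le_rowNorm_sq {m n : ℕ} (A : Matrix (Fin m) (Fin n) ℝ) (i : Fin m) :
    A i ⬝ᵥ A i ≤ rowNorm A ^ 2 := by
  rw [← Real.sqrt_le_left (rowNorm_nonneg A)]
  exact sqrt_dotProduct_self_le_rowNorm A i

theorem abs_dotProduct_le_rowNorm_mul {m n d : ℕ} (A : Matrix (Fin m) (Fin d) ℝ)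
    (B : Matrix (Fin n) (Fin d) ℝ) (i : Fin m) (l : Fin n) :
    |A i ⬝ᵥ B l| ≤ rowNorm A * rowNorm B := by
  have hA := rowNorm_nonneg A
  have hB := rowNorm_nonneg B
  rw [← abs_of_nonneg (mul_nonneg hA hB), ← sq_le_sq, mul_pow]
  refine le_trans ?_ (mul_le_mul (dotProduct_self_le_rowNorm_sq A i)
    (dotProduct_self_le_rowNorm_sq B l) (dotProduct_self_nonneg' _) (sq_nonneg _))
  have := Finset.sum_mul_sq_le_sq_mul_sq Finset.univ (A i) (B l)
  simpa only [dotProduct, sq] using this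

/-! ## The output as a function of the final state of the loop -/

/-- The output of the attention approximation computed from the final state of the loop. -/
noncomputable def nysOutput {n d r : ℕ} (β : ℝ) (Q K V : Matrix (Fin n) (Fin d) ℝ)
    (st : NysState n d r) : Matrix (Fin n) (Fin d) ℝ :=
  let W : Matrix (Fin r) (Fin n) ℝ := Matrix.of fun a l => ∑ b, st.M a b * st.R b l
  (wtdAttn β Q (Matrix.of fun a j => st.KS a j + (∑ l, K l j) / n)
    (Matrix.of fun a j => ∑ l, W a l * V l j) (fun a => ∑ l, W a l)
    (fun j => ⨅ l, V l j) (fun j => ⨆ l, V l j)).val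

theorem rowNormT_val {m k : ℕ} (A : Matrix (Fin m) (Fin k) ℝ) :
    (rowNormT A).val = rowNorm A := by
  simp only [rowNorm, sq]
  rfl

theorem kernelT_val {d : ℕ} (β τ : ℝ) (x y : Fin d → ℝ) :
    (kernelT β τ x y).val = Real.exp (β * (x ⬝ᵥ y) / (τ * τ)) := rfl

/-- All randomness lies in the loop; the remainder of the program is a function of its final state.
-/
theorem mean_wildCat {n d r : ℕ} (β : ℝ) (Q K V : Matrix (Fin n) (Fin d) ℝ)
    (g : Matrix (Fin n) (Fin d) ℝ → ℝ≥0∞) :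
    (wildCat β r Q K V).mean g =
      (nysLoop (kernelT β (temperatureT β (rowNorm Q) (rowNorm (recentre K)) n).val) (recentre K)
        (⟨0, 0, 0, fun l => (kernelT β
          (temperatureT β (rowNorm Q) (rowNorm (recentre K)) n).val
          (recentre K l) (recentre K l)).val⟩ : NysState n d r) r).mean
        fun st => g (nysOutput β Q K V st) := by
  simp only [wildCat, compressKV, rpNys, RandT.mean_bind, RandT.mean_lift, RandT.mean_pure]
  have h1 : (tabMatT fun (l : Fin n) (j : Fin d) => subT (K l j) ((tabT fun j => (do
      let z ← sumT fun l => pure (K l j)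
      divT z n : Timed ℝ)).val j)).val = recentre K := rfl
  simp only [h1, rowNormT_val]
  rfl

theorem nysOutput_apply {n d r : ℕ} (β : ℝ) (Q K V : Matrix (Fin n) (Fin d) ℝ)
    (st : NysState n d r) (i : Fin n) (j : Fin d) :
    nysOutput β Q K V st i j =
      min (⨆ l, V l j) (max (⨅ l, V l j)
        (if 0 < ∑ a, Real.exp (β * (Q i ⬝ᵥ fun j => st.KS a j + (∑ l, K l j) / n)) *
            ∑ l, ∑ b, st.M a b * st.R b l then
          (∑ a, Real.exp (β * (Q i ⬝ᵥ fun j => st.KS a j + (∑ l, K l j) / n)) *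
            ∑ l, (∑ b, st.M a b * st.R b l) * V l j) /
          (∑ a, Real.exp (β * (Q i ⬝ᵥ fun j => st.KS a j + (∑ l, K l j) / n)) *
            ∑ l, ∑ b, st.M a b * st.R b l) else 0)) := rfl

/-! ## Clipped quotients -/

/-- Clipping is 1-Lipschitz and fixes `o`. -/
theorem abs_sub_clip_le {o y lo hi : ℝ} (h1 : lo ≤ o) (h2 : o ≤ hi) :
    |o - min hi (max lo y)| ≤ |o - y| := by
  have h3 := neg_abs_le (o - y)
  have h4 := le_abs_self (o - y)
  have h5 := abs_nonneg (o - y)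
  rcases le_total lo y with h | h
  · rw [max_eq_right h]
    rcases le_total hi y with h' | h'
    · rw [min_eq_left h', abs_le]; constructor <;> linarith
    · rw [min_eq_right h']
  · rw [max_eq_left h, min_eq_right (h1.trans h2), abs_le]; constructor <;> linarith

theorem abs_sub_clip_le_two_mul {o y lo hi C : ℝ} (h1 : lo ≤ o) (h2 : o ≤ hi) (hlo : -C ≤ lo)
    (hhi : hi ≤ C) : |o - min hi (max lo y)| ≤ 2 * C := by
  have h3 : min hi (max lo y) ≤ hi := min_le_left _ _
  have h4 : lo ≤ min hi (max lo y) := le_min (h1.trans h2) (le_max_left _ _)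
  rw [abs_le]
  constructor <;> linarith

/-- If D ≤ 2η, clipping alone gives 2C; this includes every case with D' ≤ 0. Otherwise D' > D/2 and
the quotient is stable. -/
theorem abs_div_sub_clip_le {N D N' D' η C lo hi : ℝ} (hD : 0 < D) (hC : 0 ≤ C)
    (hN : |N - N'| ≤ η * C) (hDD : |D - D'| ≤ η) (h1 : lo ≤ N / D) (h2 : N / D ≤ hi)
    (hlo : -C ≤ lo) (hhi : hi ≤ C) :
    |N / D - min hi (max lo (if 0 < D' then N' / D' else 0))| ≤ 4 * (η / D) * C := by
  by_cases hη : D ≤ 2 * η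
  · refine (abs_sub_clip_le_two_mul h1 h2 hlo hhi).trans ?_
    gcongr
    rw [← mul_div_assoc, le_div_iff₀ hD]
    linarith
  · push Not at hη
    have hDD' := abs_le.1 hDD
    have hD' : D / 2 < D' := by linarith
    have hD'0 : 0 < D' := by linarith
    rw [if_pos hD'0]
    refine (abs_sub_clip_le h1 h2).trans ?_
    have heq : N / D - N' / D' = ((N - N') - N / D * (D - D')) / D' := by
      field_simp; ring
    have ho : |N / D| ≤ C := abs_le.2 ⟨hlo.trans h1, h2.trans hhi⟩
    have hη0 : 0 ≤ η := (abs_nonneg _).trans hDD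
    rw [heq, abs_div, abs_of_pos hD'0, div_le_iff₀ hD'0]
    calc |N - N' - N / D * (D - D')| ≤ |N - N'| + |N / D * (D - D')| := abs_sub _ _
      _ ≤ η * C + C * η := by
          rw [abs_mul]
          gcongr
      _ = 4 * (η / D) * C * (D / 2) := by field_simp; ring
      _ ≤ 4 * (η / D) * C * D' := by gcongr

/-! ## Error of the attention approximation -/

theorem iInf_le_weighted_mean {n : ℕ} (hn : 1 ≤ n) (a v : Fin n → ℝ) (ha : ∀ l, 0 < a l) :
    0 < ∑ l, a l ∧ (⨅ l, v l) ≤ (∑ l, a l * v l) / ∑ l, a l ∧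
      (∑ l, a l * v l) / ∑ l, a l ≤ ⨆ l, v l := by
  have : Nonempty (Fin n) := ⟨⟨0, hn⟩⟩
  have hD : 0 < ∑ l, a l := Finset.sum_pos (fun l _ => ha l) Finset.univ_nonempty
  refine ⟨hD, ?_, ?_⟩
  · rw [le_div_iff₀ hD, Finset.mul_sum]
    refine Finset.sum_le_sum fun l _ => ?_
    rw [mul_comm]
    exact mul_le_mul_of_nonneg_left (ciInf_le (Set.finite_range _).bddBelow l) (ha l).le
  · rw [div_le_iff₀ hD, Finset.mul_sum]
    refine Finset.sum_le_sum fun l _ => ?_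
    rw [mul_comm]
    exact mul_le_mul_of_nonneg_right (le_ciSup (Set.finite_range _).bddAbove l) (ha l).le

theorem neg_maxNorm_le_iInf {n d : ℕ} (hn : 1 ≤ n) (V : Matrix (Fin n) (Fin d) ℝ) (j : Fin d) :
    -maxNorm V ≤ ⨅ l, V l j := by
  have : Nonempty (Fin n) := ⟨⟨0, hn⟩⟩
  exact le_ciInf fun l => (abs_le.1 (abs_le_maxNorm V l j)).1

theorem iSup_le_maxNorm {n d : ℕ} (hn : 1 ≤ n) (V : Matrix (Fin n) (Fin d) ℝ) (j : Fin d) :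
    (⨆ l, V l j) ≤ maxNorm V := by
  have : Nonempty (Fin n) := ⟨⟨0, hn⟩⟩
  exact ciSup_le fun l => (abs_le.1 (abs_le_maxNorm V l j)).2

theorem maxNorm_sub_nysOutput_le_two_mul {n d r : ℕ} (hn : 1 ≤ n) (β : ℝ)
    (Q K V : Matrix (Fin n) (Fin d) ℝ) (st : NysState n d r) :
    maxNorm (softmaxAttention β Q K V - nysOutput β Q K V st) ≤ 2 * maxNorm V := by
  refine maxNorm_le (mul_nonneg zero_le_two (maxNorm_nonneg V)) fun i j => ?_
  obtain ⟨-, h1, h2⟩ := iInf_le_weighted_mean hn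
    (fun l => Real.exp (β * (Q i ⬝ᵥ K l))) (fun l => V l j) fun l => Real.exp_pos _
  rw [Matrix.sub_apply, nysOutput_apply]
  exact abs_sub_clip_le_two_mul h1 h2 (neg_maxNorm_le_iInf hn V j) (iSup_le_maxNorm hn V j)

/-- With a single key the clipping interval is a point. Exactness is needed because log 1 = 0 makes
the claimed bound vanish. -/
theorem maxNorm_sub_nysOutput_of_one {d r : ℕ} (β : ℝ)
    (Q K V : Matrix (Fin 1) (Fin d) ℝ) (st : NysState 1 d r) :
    maxNorm (softmaxAttention β Q K V - nysOutput β Q K V st) ≤ 0 := by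
  refine maxNorm_le le_rfl fun i j => ?_
  obtain ⟨-, h1, h2⟩ := iInf_le_weighted_mean le_rfl
    (fun l => Real.exp (β * (Q i ⬝ᵥ K l))) (fun l => V l j) fun l => Real.exp_pos _
  have hsup : (⨆ l, V l j) = V 0 j := ciSup_unique
  have hinf : (⨅ l, V l j) = V 0 j := ciInf_unique
  rw [Matrix.sub_apply, nysOutput_apply, min_eq_left (by rw [hsup, hinf]; exact le_max_left _ _),
    abs_nonpos_iff, sub_eq_zero]
  exact le_antisymm h2 (by rw [hsup, ← hinf]; exact h1)

/-- Pairing `u i` with key features reproduces the attention weights, so numerator and denominator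
err by pairings with residuals. The mean key contributes a common factor `c`, which cancels in the
relative error. -/
theorem maxNorm_sub_nysOutput_le {H : Type*} [NormedAddCommGroup H] [InnerProductSpace ℝ H]
    {n d r : ℕ} (hn : 1 ≤ n) {β ρ B : ℝ} (Q K V : Matrix (Fin n) (Fin d) ℝ)
    (Φ : (Fin d → ℝ) → H) (u : Fin n → H) (st : NysState n d r)
    (hK : ∀ i l, Real.exp (β * (Q i ⬝ᵥ recentre K l)) = inner ℝ (u i) (Φ (recentre K l)))
    (hS : ∀ i a, Real.exp (β * (Q i ⬝ᵥ st.KS a)) = inner ℝ (u i) (Φ (st.KS a)))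
    (hu : ∀ i, ‖u i‖ ≤ B) (hρ : ∀ i l, -ρ ≤ β * (Q i ⬝ᵥ recentre K l)) :
    maxNorm (softmaxAttention β Q K V - nysOutput β Q K V st) ≤
      4 * (Real.exp ρ * B * Real.sqrt (energy (residual Φ (recentre K) st))) * maxNorm V := by
  set X := energy (residual Φ (recentre K) st) with hX
  have hnpos : (0 : ℝ) < n := by exact_mod_cast hn
  have hB : 0 ≤ B := (norm_nonneg _).trans (hu ⟨0, hn⟩)
  have hV := maxNorm_nonneg V
  refine maxNorm_le (by positivity) fun i j => ?_
  set kb : Fin d → ℝ := fun j => (∑ l, K l j) / n with hkb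
  set c := Real.exp (β * (Q i ⬝ᵥ kb)) with hc
  have hcpos : 0 < c := Real.exp_pos _
  have hKl : ∀ l, Real.exp (β * (Q i ⬝ᵥ K l)) = c * Real.exp (β * (Q i ⬝ᵥ recentre K l)) := by
    intro l
    have : K l = kb + recentre K l := by
      funext j; simp [hkb, recentre]
    rw [hc, ← Real.exp_add, ← mul_add, ← dotProduct_add, ← this]
  have hSa : ∀ a, Real.exp (β * (Q i ⬝ᵥ fun j => st.KS a j + (∑ l, K l j) / n)) =
      c * inner ℝ (u i) (Φ (st.KS a)) := by
    intro a
    have : (fun j => st.KS a j + (∑ l, K l j) / n) = kb + st.KS a := by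
      funext j; simp [hkb, add_comm]
    rw [this, dotProduct_add, mul_add, Real.exp_add, hS]
  set ε : Fin n → ℝ := fun l => inner ℝ (u i) (residual Φ (recentre K) st l) with hε
  -- One identity for both: `f` is a column of `V` in the numerator and 1 in the denominator.
  have happrox : ∀ f : Fin n → ℝ,
      ∑ a, Real.exp (β * (Q i ⬝ᵥ fun j => st.KS a j + (∑ l, K l j) / n)) *
        ∑ l, (∑ b, st.M a b * st.R b l) * f l =
      ∑ l, (Real.exp (β * (Q i ⬝ᵥ K l)) - c * ε l) * f l := by
    intro f
    simp_rw [hSa, Finset.mul_sum]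
    rw [Finset.sum_comm]
    refine Finset.sum_congr rfl fun l _ => ?_
    rw [hKl, hK, hε]
    simp only [residual, inner_sub_right, inner_sum, inner_smul_right]
    rw [← mul_sub, sub_sub_cancel, Finset.mul_sum, Finset.sum_mul]
    exact Finset.sum_congr rfl fun a _ => by ring
  have hεl : ∀ l, |ε l| ≤ B * Real.sqrt X := by
    intro l
    refine (abs_real_inner_le_norm _ _).trans (mul_le_mul (hu i) ?_ (norm_nonneg _) hB)
    refine Real.le_sqrt_of_sq_le ?_
    exact Finset.single_le_sum (f := fun l => ‖residual Φ (recentre K) st l‖ ^ 2)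
      (fun _ _ => sq_nonneg _) (Finset.mem_univ l)
  set D := ∑ l, Real.exp (β * (Q i ⬝ᵥ K l)) with hD
  set η := c * (n * (B * Real.sqrt X)) with hη
  have hsumε : ∑ l, |c * ε l| ≤ η := by
    calc ∑ l, |c * ε l| ≤ ∑ _l : Fin n, c * (B * Real.sqrt X) := by
          refine Finset.sum_le_sum fun l _ => ?_
          rw [abs_mul, abs_of_pos hcpos]
          gcongr
          exact hεl l
      _ = η := by
          rw [Finset.sum_const, Finset.card_univ, Fintype.card_fin, nsmul_eq_mul, hη]; ring
  have hDlow : c * (n * Real.exp (-ρ)) ≤ D := by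
    calc c * (n * Real.exp (-ρ)) = ∑ _l : Fin n, c * Real.exp (-ρ) := by
          rw [Finset.sum_const, Finset.card_univ, Fintype.card_fin, nsmul_eq_mul]; ring
      _ ≤ D := by
          refine Finset.sum_le_sum fun l _ => ?_
          rw [hKl]
          gcongr
          exact hρ i l
  obtain ⟨hDpos, h1, h2⟩ := iInf_le_weighted_mean hn
    (fun l => Real.exp (β * (Q i ⬝ᵥ K l))) (fun l => V l j) fun l => Real.exp_pos _
  have happrox1 := happrox fun _ => 1
  simp only [mul_one] at happrox1
  rw [Matrix.sub_apply, nysOutput_apply, happrox1, happrox fun l => V l j]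
  have hmain := abs_div_sub_clip_le (N' := ∑ l, (Real.exp (β * (Q i ⬝ᵥ K l)) - c * ε l) * V l j)
    (D' := ∑ l, (Real.exp (β * (Q i ⬝ᵥ K l)) - c * ε l)) (η := η) hDpos hV ?_ ?_ h1 h2
    (neg_maxNorm_le_iInf hn V j) (iSup_le_maxNorm hn V j)
  · refine hmain.trans ?_
    gcongr
    rw [div_le_iff₀ hDpos]
    calc η = Real.exp ρ * B * Real.sqrt X * (c * (n * Real.exp (-ρ))) := by
          rw [hη, Real.exp_neg]; field_simp
      _ ≤ _ := by gcongr
  · rw [← Finset.sum_sub_distrib]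
    refine (Finset.abs_sum_le_sum_abs _ _).trans ?_
    refine le_trans ?_ (mul_le_mul_of_nonneg_right hsumε hV)
    rw [Finset.sum_mul]
    refine Finset.sum_le_sum fun l _ => ?_
    rw [← sub_mul, sub_sub_cancel, abs_mul]
    gcongr
    exact abs_le_maxNorm V l j
  · rw [← Finset.sum_sub_distrib]
    refine (Finset.abs_sum_le_sum_abs _ _).trans (le_trans (le_of_eq ?_) hsumε)
    exact Finset.sum_congr rfl fun l _ => by rw [sub_sub_cancel]

/-! ## Lambert function and temperature -/

theorem lambertW_spec {z : ℝ} (hz : 0 < z) :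
    0 < lambertW z ∧ lambertW z * Real.exp (lambertW z) = z := by
  have hex : ∃ w : ℝ, -1 < w ∧ w * Real.exp w = z := by
    have hcont : ContinuousOn (fun w : ℝ => w * Real.exp w) (Set.Icc 0 z) := by fun_prop
    have hmem : z ∈ Set.Icc ((0 : ℝ) * Real.exp 0) (z * Real.exp z) :=
      ⟨by simpa using hz.le, le_mul_of_one_le_right hz.le (Real.one_le_exp hz.le)⟩
    obtain ⟨w, hw, hwz⟩ := intermediate_value_Icc hz.le hcont hmem
    exact ⟨w, by linarith [hw.1], hwz⟩
  have hspec : -1 < lambertW z ∧ lambertW z * Real.exp (lambertW z) = z := by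
    rw [lambertW, dif_pos hex]
    exact hex.choose_spec
  refine ⟨?_, hspec.2⟩
  by_contra h
  have := mul_nonpos_of_nonpos_of_nonneg (not_lt.1 h) (Real.exp_pos (lambertW z)).le
  linarith [hspec.2]

theorem lambertW_le_self {z : ℝ} (hz : 0 < z) : lambertW z ≤ z := by
  obtain ⟨h1, h2⟩ := lambertW_spec hz
  nlinarith [Real.one_le_exp h1.le]

theorem le_lambertW {w z : ℝ} (hw : 0 ≤ w) (hz : 0 < z) (h : w * Real.exp w ≤ z) :
    w ≤ lambertW z := by
  obtain ⟨h1, h2⟩ := lambertW_spec hz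
  by_contra hlt
  push Not at hlt
  have h3 : lambertW z * Real.exp (lambertW z) < w * Real.exp w :=
    mul_lt_mul hlt (Real.exp_le_exp.2 hlt.le) (Real.exp_pos _) hw
  linarith

theorem one_le_rho0 : 1 ≤ rho0 := by
  rw [rho0, Real.one_le_sqrt]
  linarith [Real.exp_pos (lambertW (2 / Real.exp 1 ^ 2) + 2)]

theorem three_le_kappa : 3 ≤ kappa := by
  have := one_le_rho0
  rw [kappa]; linarith

/-- The two regimes of the temperature. -/
theorem temperatureT_cases {β RQ RK R : ℝ} {n : ℕ} (hn : 2 ≤ n) (hβ : 0 < β) (hQ : 0 ≤ RQ)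
    (hK : 0 ≤ RK) (hρ : β * RQ * RK ≤ R) (hlog : R * rho0 * Real.exp (1 / 2) ≤ Real.log n) :
    ((temperatureT β RQ RK n).val = 0 ∧ RQ * RK = 0) ∨
      (0 < (temperatureT β RQ RK n).val ∧ 0 < RQ ∧ 0 < RK ∧ ∃ q : ℝ, 1 ≤ q ∧
        β * RQ * RK * q ≤ Real.log n + 2 * R ∧ (temperatureT β RQ RK n).val ^ 2 = RK / RQ * q) := by
  have hL : 0 < Real.log n := Real.log_pos (by exact_mod_cast hn)
  rw [temperatureT_val]
  rcases hQ.eq_or_lt with h | hQ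
  · exact Or.inl ⟨by simp [← h], by simp [← h]⟩
  rcases hK.eq_or_lt with h | hK
  · exact Or.inl ⟨by simp [← h], by simp [← h]⟩
  right
  set ρ := β * RQ * RK with hρdef
  have hρ0 : 0 < ρ := by positivity
  set b := Real.log n / ρ + 2 with hb
  have hb0 : 0 < b := by positivity
  have hr0 : 0 < rho0 := zero_lt_one.trans_le one_le_rho0
  have hz : 0 < b / (2 * rho0) := by positivity
  set W := lambertW (b / (2 * rho0)) with hW
  have hW0 : 0 < W := (lambertW_spec hz).1
  have hWle : W ≤ b / (2 * rho0) := lambertW_le_self hz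
  have hWge : 1 / 2 ≤ W := by
    -- At w = 1/2 the condition w e^w ≤ b/(2ρ₀) reads ρ₀ e^{1/2} ≤ b, which follows from `hlog`.
    refine le_lambertW (by norm_num) hz ?_
    rw [le_div_iff₀ (by positivity)]
    have h1 : ρ * rho0 * Real.exp (1 / 2) ≤ Real.log n := le_trans (by gcongr) hlog
    have h2 : rho0 * Real.exp (1 / 2) ≤ Real.log n / ρ := by
      rw [le_div_iff₀ hρ0]; linarith
    linarith
  have hq1 : 1 ≤ b / (2 * W) := by
    rw [le_div_iff₀ (by positivity)]
    rw [le_div_iff₀ (by positivity)] at hWle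
    nlinarith [one_le_rho0]
  have hpos : 0 < RK / RQ * (b / (2 * W)) := by positivity
  refine ⟨Real.sqrt_pos.2 hpos, hQ, hK, b / (2 * W), hq1, ?_, Real.sq_sqrt hpos.le⟩
  have h1 : b / (2 * W) ≤ b := div_le_self hb0.le (by linarith)
  calc ρ * (b / (2 * W)) ≤ ρ * b := by gcongr
    _ = Real.log n + 2 * ρ := by rw [hb]; field_simp
    _ ≤ _ := by linarith

/-! ## Expected error for a fixed degree of approximation -/

theorem expect_wildCat_le_two_mul {n d r : ℕ} (hn : 1 ≤ n) (β : ℝ)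
    (Q K V : Matrix (Fin n) (Fin d) ℝ) :
    (wildCat β r Q K V).expect (fun O => maxNorm (softmaxAttention β Q K V - O)) ≤
      ENNReal.ofReal (2 * maxNorm V) := by
  rw [RandT.expect_eq_mean, mean_wildCat]
  refine (RandT.mean_mono (g := fun _ => ENNReal.ofReal (2 * maxNorm V)) fun ω _ => ?_).trans
    (RandT.mean_const _ _).le
  exact ENNReal.ofReal_le_ofReal (maxNorm_sub_nysOutput_le_two_mul hn β Q K V ω.val)

theorem expect_wildCat_of_one {d r : ℕ} (β : ℝ) (Q K V : Matrix (Fin 1) (Fin d) ℝ) :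
    (wildCat β r Q K V).expect (fun O => maxNorm (softmaxAttention β Q K V - O)) = 0 := by
  rw [RandT.expect_eq_mean, mean_wildCat, ← nonpos_iff_eq_zero]
  refine (RandT.mean_mono (g := fun _ => 0) fun ω _ => ?_).trans (RandT.mean_const _ _).le
  rw [nonpos_iff_eq_zero]
  exact ENNReal.ofReal_eq_zero.2 (maxNorm_sub_nysOutput_of_one β Q K V ω.val)

/-- AM–GM with a free parameter: it makes the error linear in the energy, so expectations pass
through directly. -/
theorem sqrt_le_half_add {x c : ℝ} (hx : 0 ≤ x) (hc : 0 < c) :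
    Real.sqrt x ≤ 1 / (2 * c) * x + c / 2 := by
  have h : Real.sqrt x ^ 2 = x := Real.sq_sqrt hx
  have : 1 / (2 * c) * x + c / 2 - Real.sqrt x = (Real.sqrt x - c) ^ 2 / (2 * c) := by
    rw [sub_sq, h]; field_simp; ring
  have h2 : 0 ≤ (Real.sqrt x - c) ^ 2 / (2 * c) := by positivity
  linarith

theorem expect_wildCat_le {n d r s : ℕ} (hn : 2 ≤ n) (hs : 1 ≤ s) (hr : 3 * (s ^ d) ^ 2 ≤ r)
    {β R c : ℝ} (hβ : 0 < β) (Q K V : Matrix (Fin n) (Fin d) ℝ)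
    (hρ : β * rowNorm Q * rowNorm (recentre K) ≤ R)
    (hlog : R * rho0 * Real.exp (1 / 2) ≤ Real.log n) (hc : 0 < c)
    (hcs : 3 * (n * (d * (R ^ s / s.factorial) * Real.exp R)) ≤ c ^ 2) :
    (wildCat β r Q K V).expect (fun O => maxNorm (softmaxAttention β Q K V - O)) ≤
      ENNReal.ofReal (4 * (Real.exp R * Real.sqrt (n * Real.exp (2 * R)) * c) * maxNorm V) := by
  set RQ := rowNorm Q with hRQ
  set RK := rowNorm (recentre K) with hRK
  have hQ0 : 0 ≤ RQ := rowNorm_nonneg Q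
  have hK0 : 0 ≤ RK := rowNorm_nonneg _
  have hρ0 : 0 ≤ β * RQ * RK := by positivity
  have hR0 : 0 ≤ R := hρ0.trans hρ
  have hn0 : (0 : ℝ) < n := by exact_mod_cast (by omega : 0 < n)
  have hcases := temperatureT_cases hn hβ hQ0 hK0 hρ hlog
  rw [RandT.expect_eq_mean, mean_wildCat, ← hRQ, ← hRK]
  set τ := (temperatureT β RQ RK n).val with hτ
  -- Keys are scaled by 1/τ and queries by τ, so the pairing does not see τ. If τ = 0, both scalings
  -- are 0 and the kernel is constantly 1.
  set Φ : (Fin d → ℝ) → lp (fun _ : Fin d → ℕ => ℝ) 2 :=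
    fun x => expFeature ((Real.sqrt β / τ) • x) with hΦdef
  set u : Fin n → lp (fun _ : Fin d → ℕ => ℝ) 2 :=
    fun i => expFeature ((Real.sqrt β * τ) • Q i) with hudef
  have hsqβ : Real.sqrt β * Real.sqrt β = β := Real.mul_self_sqrt hβ.le
  have hΦ : ∀ x y, (kernelT β τ x y).val = inner ℝ (Φ x) (Φ y) := by
    intro x y
    rw [kernelT_val, hΦdef, inner_expFeature, smul_dotProduct, dotProduct_smul, smul_eq_mul,
      smul_eq_mul, ← mul_assoc, div_mul_div_comm, hsqβ]
    congr 1
    ring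
  have hnorm : ∀ l, ((Real.sqrt β / τ) • recentre K l) ⬝ᵥ ((Real.sqrt β / τ) • recentre K l) ≤
      R := by
    intro l
    rw [smul_dotProduct, dotProduct_smul, smul_eq_mul, smul_eq_mul, ← mul_assoc,
      div_mul_div_comm, hsqβ]
    rcases hcases with ⟨h0, -⟩ | ⟨hτ0, hQ, hK, q, hq1, -, hτq⟩
    · rw [h0]; simpa using hR0
    · have h1 : recentre K l ⬝ᵥ recentre K l ≤ RK ^ 2 := dotProduct_self_le_rowNorm_sq _ l
      rw [← sq, hτq]
      calc β / (RK / RQ * q) * (recentre K l ⬝ᵥ recentre K l)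
          ≤ β / (RK / RQ * q) * RK ^ 2 := by gcongr
        _ = β * RQ * RK / q := by field_simp
        _ ≤ β * RQ * RK := div_le_self hρ0 hq1
        _ ≤ R := hρ
  have hu : ∀ i, ‖u i‖ ≤ Real.sqrt (n * Real.exp (2 * R)) := by
    intro i
    refine Real.le_sqrt_of_sq_le ?_
    rw [← real_inner_self_eq_norm_sq, hudef, inner_expFeature, smul_dotProduct, dotProduct_smul,
      smul_eq_mul, smul_eq_mul]
    have hexp : (n : ℝ) * Real.exp (2 * R) = Real.exp (Real.log n + 2 * R) := by
      rw [Real.exp_add, Real.exp_log hn0]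
    rw [hexp, Real.exp_le_exp]
    have h1 : Real.sqrt β * τ * (Real.sqrt β * τ * (Q i ⬝ᵥ Q i)) = β * τ ^ 2 * (Q i ⬝ᵥ Q i) := by
      rw [← mul_assoc, mul_mul_mul_comm, hsqβ]; ring
    rw [h1]
    rcases hcases with ⟨h0, -⟩ | ⟨hτ0, hQ, hK, q, hq1, hq2, hτq⟩
    · have := Real.log_natCast_nonneg n
      rw [h0]
      nlinarith
    · refine le_trans ?_ hq2
      rw [hτq]
      calc β * (RK / RQ * q) * (Q i ⬝ᵥ Q i) ≤ β * (RK / RQ * q) * RQ ^ 2 := by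
            gcongr
            exact dotProduct_self_le_rowNorm_sq _ i
        _ = β * RQ * RK * q := by field_simp
  have hQK : ∀ i l, |Q i ⬝ᵥ recentre K l| ≤ RQ * RK := fun i l =>
    abs_dotProduct_le_rowNorm_mul Q (recentre K) i l
  have hinner : ∀ i y, (y = 0 ∨ ∃ l, y = recentre K l) →
      Real.exp (β * (Q i ⬝ᵥ y)) = inner ℝ (u i) (Φ y) := by
    intro i y hy
    rw [hudef, hΦdef, inner_expFeature, smul_dotProduct, dotProduct_smul, smul_eq_mul,
      smul_eq_mul]
    congr 1
    -- For τ = 0 the inner product must vanish: for keys because R_Q R_K = 0, for unfilled coreset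
    -- rows because they are zero.
    rcases hcases with ⟨h0, h0'⟩ | ⟨hτ0, -⟩
    · have hz : Q i ⬝ᵥ y = 0 := by
        rcases hy with rfl | ⟨l, rfl⟩
        · simp
        · exact abs_nonpos_iff.1 ((hQK i l).trans h0'.le)
      rw [hz]; simp
    · rw [← mul_assoc, show Real.sqrt β * τ * (Real.sqrt β / τ) = Real.sqrt β * Real.sqrt β by
        field_simp, hsqβ]
  have hlow : ∀ i l, -R ≤ β * (Q i ⬝ᵥ recentre K l) := by
    intro i l
    have h1 := (abs_le.1 (hQK i l)).1
    have h2 := mul_le_mul_of_nonneg_left h1 hβ.le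
    linarith
  have inv := NysInvariant.init (K := recentre K) (r := r) hΦ
  set st₀ : NysState n d r := ⟨0, 0, 0, fun l => (kernelT β τ (recentre K l) (recentre K l)).val⟩
  have htail : tailEnergy (s ^ d) (residual Φ (recentre K) st₀) ≤
      n * (d * (R ^ s / s.factorial) * Real.exp R) := by
    rw [residual_init]
    refine (tailEnergy_expFeature_le s (fun l => (Real.sqrt β / τ) • recentre K l)
      hnorm hR0).trans (le_of_eq ?_)
    rw [Fintype.card_fin]
  have hmean := mean_nysLoop_energy_le_three_mul hΦ inv (Nat.one_le_pow _ _ hs) hr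
  set B := Real.sqrt (n * Real.exp (2 * R)) with hB
  have hB0 : 0 ≤ B := Real.sqrt_nonneg _
  have hV := maxNorm_nonneg V
  set a := 4 * (Real.exp R * B) * maxNorm V with ha
  have ha0 : 0 ≤ a := by positivity
  have hpoint : ∀ ω ∈ (nysLoop (kernelT β τ) (recentre K) st₀ r).outcomes,
      ENNReal.ofReal (maxNorm (softmaxAttention β Q K V - nysOutput β Q K V ω.val)) ≤
        ENNReal.ofReal (a / (2 * c)) *
          ENNReal.ofReal (energy (residual Φ (recentre K) ω.val)) +
          ENNReal.ofReal (a * (c / 2)) := by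
    intro ω hω
    have hX := energy_nonneg (residual Φ (recentre K) ω.val)
    rw [← ENNReal.ofReal_mul (by positivity), ← ENNReal.ofReal_add (by positivity) (by positivity)]
    refine ENNReal.ofReal_le_ofReal ?_
    refine (maxNorm_sub_nysOutput_le (by omega) Q K V Φ u ω.val
      (fun i l => hinner i _ (Or.inr ⟨l, rfl⟩))
      (fun i b => hinner i _ ((inv.loop hΦ 0 le_rfl hω).1.keys b)) hu hlow).trans ?_
    calc _ = a * Real.sqrt (energy (residual Φ (recentre K) ω.val)) := by rw [ha]; ring
      _ ≤ a * (1 / (2 * c) * energy (residual Φ (recentre K) ω.val) + c / 2) := by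
          gcongr
          exact sqrt_le_half_add hX hc
      _ = _ := by ring
  refine (RandT.mean_mono (g := fun st => ENNReal.ofReal (a / (2 * c)) *
    ENNReal.ofReal (energy (residual Φ (recentre K) st)) + ENNReal.ofReal (a * (c / 2)))
    hpoint).trans ?_
  rw [RandT.mean_add, RandT.mean_const_mul, RandT.mean_const]
  calc _ ≤ ENNReal.ofReal (a / (2 * c)) * ENNReal.ofReal (c ^ 2) + ENNReal.ofReal (a * (c / 2)) := by
        gcongr
        refine hmean.trans (ENNReal.ofReal_le_ofReal (le_trans ?_ hcs))
        gcongr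
    _ = _ := by
        rw [← ENNReal.ofReal_mul (by positivity), ← ENNReal.ofReal_add (by positivity)
          (by positivity)]
        congr 1
        rw [ha]
        field_simp
        ring

/-! ## Expected error for large `n` -/

/-- Since s! ≥ (s/e)^s, the quotient is at most (eR/s)^s, and s ≥ 6 log n pushes the base below
e^{-θ}. -/
theorem pow_div_factorial_le_exp_neg {n s : ℕ} {R : ℝ} (hR : 0 < R)
    (hκ : kappa * R ≤ Real.log n) (hs : 6 * Real.log n ≤ s) :
    R ^ s / s.factorial ≤
      Real.exp (-(6 * Real.log n * (1 + Real.log (1 + Real.log n / (kappa * R))))) := by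
  have hκ3 := three_le_kappa
  have hκR : 0 < kappa * R := by positivity
  set ℓ := Real.log n with hℓ
  have hℓ0 : 0 < ℓ := hκR.trans_le hκ
  have hs0 : (0 : ℝ) < s := by linarith
  set y := 1 + ℓ / (kappa * R) with hy
  have hy1 : 1 ≤ y := by rw [hy]; linarith [div_pos hℓ0 hκR]
  have hy0 : 0 < y := by linarith
  have hθ : 0 ≤ 1 + Real.log y := by linarith [Real.log_nonneg hy1]
  have he : Real.exp 2 ≤ 9 := by
    have := Real.exp_one_lt_d9
    have h0 := Real.exp_pos 1
    rw [show (2 : ℝ) = 1 + 1 by norm_num, Real.exp_add]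
    nlinarith
  have hbase : Real.exp 1 * R / s ≤ Real.exp (-(1 + Real.log y)) := by
    rw [div_le_iff₀ hs0, Real.exp_neg, Real.exp_add, Real.exp_log hy0, ← div_eq_inv_mul,
      le_div_iff₀ (by positivity)]
    -- R y = R + ℓ/κ with κR ≤ ℓ and κ ≥ 3. Together with e² ≤ 9 this produces the 6 in the choice
    -- of `s`.
    have h1 : R * y ≤ 2 * ℓ / 3 := by
      have h2 : R * y = (kappa * R + ℓ) / kappa := by rw [hy]; field_simp
      rw [h2, div_le_div_iff₀ (by positivity) (by norm_num)]
      nlinarith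
    calc Real.exp 1 * R * (Real.exp 1 * y) = Real.exp 2 * (R * y) := by
          rw [show (2 : ℝ) = 1 + 1 by norm_num, Real.exp_add]; ring
      _ ≤ 9 * (2 * ℓ / 3) := by gcongr
      _ ≤ s := by linarith
  have hfac : R ^ s / s.factorial ≤ (Real.exp 1 * R / s) ^ s := by
    have h1 := Real.pow_div_factorial_le_exp (s : ℝ) hs0.le s
    have h2 : Real.exp s = Real.exp 1 ^ s := by rw [← Real.exp_nat_mul, mul_one]
    rw [h2] at h1
    rw [div_pow, mul_pow, le_div_iff₀ (by positivity)]
    calc R ^ s / s.factorial * (s : ℝ) ^ s = (s : ℝ) ^ s / s.factorial * R ^ s := by ring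
      _ ≤ _ := by gcongr
  calc R ^ s / s.factorial ≤ (Real.exp 1 * R / s) ^ s := hfac
    _ ≤ Real.exp (-(1 + Real.log y)) ^ s := by gcongr
    _ = Real.exp (-(s * (1 + Real.log y))) := by rw [← Real.exp_nat_mul]; congr 1; ring
    _ ≤ _ := by
        rw [Real.exp_le_exp, neg_le_neg_iff]
        gcongr

theorem expect_wildCat_le_of_large {n d r D : ℕ} {t R R' : ℝ} (ht : 0 < t) (ht1 : t < 1)
    (hd : d ≤ D) (hR : 0 < R) (hRR : R ≤ R') (hℓ1 : 1 ≤ Real.log n)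
    (hlog : R' * rho0 * Real.exp (1 / 2) ≤ Real.log n) (hκ : kappa * R' ≤ Real.log n)
    (hr : 3 * (7 * Real.log n) ^ (2 * D) + 1 ≤ (n : ℝ) ^ (t / 2))
    (hrn : |(r : ℝ) - (n : ℝ) ^ (t / 2)| < 1) {β : ℝ} (hβ : 0 < β)
    (Q K V : Matrix (Fin n) (Fin d) ℝ)
    (hρ : β * rowNorm Q * rowNorm (recentre K) ≤ R) :
    (wildCat β r Q K V).expect (fun O => maxNorm (softmaxAttention β Q K V - O)) ≤
      ENNReal.ofReal (4 * (Real.exp R' * Real.exp R' * Real.sqrt (3 * (D + 1) * Real.exp R')) *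
        (Real.log n / (n : ℝ) ^ (0.14 * t * (1 + Real.log (1 + Real.log n / (kappa * R))))) *
          maxNorm V) := by
  have hκ3 := three_le_kappa
  have hκR : 0 < kappa * R := by positivity
  have hρ1 := one_le_rho0
  have hn2 : 2 ≤ n := by
    by_contra h
    have : n = 0 ∨ n = 1 := by omega
    rcases this with rfl | rfl <;> norm_num at hℓ1
  have hn0 : (0 : ℝ) < n := by exact_mod_cast (by omega : 0 < n)
  set ℓ := Real.log n with hℓ
  set θ := 1 + Real.log (1 + ℓ / (kappa * R)) with hθ
  have hθ1 : 1 ≤ θ := by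
    have : 0 ≤ Real.log (1 + ℓ / (kappa * R)) := Real.log_nonneg (by
      linarith [div_nonneg (zero_le_one.trans hℓ1) hκR.le])
    rw [hθ]; linarith
  have hexpℓ : Real.exp ℓ = n := Real.exp_log hn0
  set s := ⌈6 * ℓ⌉₊ with hs
  have hs6 : 6 * ℓ ≤ s := Nat.le_ceil _
  have hs7 : (s : ℝ) ≤ 7 * ℓ := by
    have := Nat.ceil_lt_add_one (a := 6 * ℓ) (by positivity)
    linarith
  have hs1 : 1 ≤ s := by
    have : (1 : ℝ) ≤ s := by linarith
    exact_mod_cast this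
  have hrank : 3 * (s ^ d) ^ 2 ≤ r := by
    have h1 : (3 * (s ^ d) ^ 2 : ℝ) ≤ 3 * (7 * ℓ) ^ (2 * D) := by
      rw [← pow_mul, mul_comm d 2]
      have h2 : (s : ℝ) ^ (2 * d) ≤ (s : ℝ) ^ (2 * D) :=
        pow_le_pow_right₀ (by exact_mod_cast hs1) (by omega)
      have h3 : (s : ℝ) ^ (2 * D) ≤ (7 * ℓ) ^ (2 * D) := by gcongr
      linarith
    have h2 := (abs_lt.1 hrn).1
    have h3 : (3 * (s ^ d) ^ 2 : ℝ) ≤ r := by linarith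
    exact_mod_cast h3
  set A := Real.sqrt (3 * (D + 1) * Real.exp R') with hA
  have hA0 : 0 < A := Real.sqrt_pos.2 (by positivity)
  have hA2 : A ^ 2 = 3 * (D + 1) * Real.exp R' := Real.sq_sqrt (by positivity)
  -- The square of `c` bounds the expected residual energy, so this balances the two terms of AM–GM.
  set c := A * Real.exp (ℓ / 2 - 3 * ℓ * θ) with hc
  have hc2 : c ^ 2 = 3 * (D + 1) * Real.exp R' * (n * Real.exp (-(6 * ℓ * θ))) := by
    rw [hc, mul_pow, hA2, ← hexpℓ, ← Real.exp_add, ← Real.exp_nat_mul]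
    congr 2
    push_cast
    ring
  have hlogR : R * rho0 * Real.exp (1 / 2) ≤ ℓ := le_trans (by gcongr) hlog
  have hκR' : kappa * R ≤ ℓ := le_trans (by gcongr) hκ
  have hdD : (d : ℝ) ≤ D + 1 := by
    have : (d : ℝ) ≤ D := by exact_mod_cast hd
    linarith
  refine (expect_wildCat_le hn2 hs1 hrank hβ Q K V hρ hlogR (c := c) (by positivity) ?_).trans
    (ENNReal.ofReal_le_ofReal ?_)
  · rw [hc2]
    calc 3 * (n * (d * (R ^ s / s.factorial) * Real.exp R))
        ≤ 3 * (n * ((D + 1) * Real.exp (-(6 * ℓ * θ)) * Real.exp R')) := by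
          gcongr
          exact pow_div_factorial_le_exp_neg hR hκR' hs6
      _ = _ := by ring
  · have hV := maxNorm_nonneg V
    refine mul_le_mul_of_nonneg_right ?_ hV
    have hsq : Real.sqrt (n * Real.exp (2 * R)) = Real.exp (ℓ / 2) * Real.exp R := by
      rw [← hexpℓ, ← Real.exp_add, ← Real.exp_add, Real.sqrt_eq_iff_mul_self_eq (by positivity)
        (by positivity), ← Real.exp_add]
      congr 1
      ring
    have hpow : (n : ℝ) ^ (0.14 * t * θ) = Real.exp (0.14 * t * θ * ℓ) := by
      rw [Real.rpow_def_of_pos hn0, mul_comm]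
    -- The exponent 1 - 3θ + 0.14tθ, times ℓ, is nonpositive because θ ≥ 1 and t < 1; of the factor
    -- log n only log n ≥ 1 is used.
    have hkey : Real.exp (ℓ / 2) * Real.exp (ℓ / 2 - 3 * ℓ * θ) ≤ ℓ / (n : ℝ) ^ (0.14 * t * θ) := by
      rw [hpow, le_div_iff₀ (Real.exp_pos _), ← Real.exp_add, ← Real.exp_add]
      refine le_trans (Real.exp_le_one_iff.2 ?_) hℓ1
      have h1 : ℓ ≤ ℓ * θ := le_mul_of_one_le_right (by linarith) hθ1
      have h2 : t * (ℓ * θ) ≤ 1 * (ℓ * θ) := by gcongr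
      nlinarith
    rw [hsq, hc]
    calc 4 * (Real.exp R * (Real.exp (ℓ / 2) * Real.exp R) * (A * Real.exp (ℓ / 2 - 3 * ℓ * θ)))
        = 4 * (Real.exp R * Real.exp R * A) *
            (Real.exp (ℓ / 2) * Real.exp (ℓ / 2 - 3 * ℓ * θ)) := by ring
      _ ≤ _ := by gcongr

theorem eventually_large {t : ℝ} (ht : 0 < t) (D : ℕ) (C : ℝ) :
    ∃ N : ℕ, ∀ n : ℕ, N ≤ n → 1 ≤ Real.log n ∧ C ≤ Real.log n ∧
      3 * (7 * Real.log n) ^ (2 * D) + 1 ≤ (n : ℝ) ^ (t / 2) := by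
  have hlim : Filter.Tendsto (fun n : ℕ => Real.log n) Filter.atTop Filter.atTop :=
    Real.tendsto_log_atTop.comp tendsto_natCast_atTop_atTop
  -- The constant yields 4 (7 log n)^{2D} ≤ n^{t/2}, and one of the four copies absorbs the summand
  -- 1.
  have ho := (isLittleO_log_rpow_rpow_atTop ((2 * D : ℕ) : ℝ) (half_pos ht)).bound
    (show (0 : ℝ) < 1 / (4 * 7 ^ (2 * D)) by positivity)
  have ho' := tendsto_natCast_atTop_atTop.eventually ho
  obtain ⟨N, hN⟩ := Filter.eventually_atTop.1
    ((hlim.eventually_ge_atTop 1).and ((hlim.eventually_ge_atTop C).and ho'))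
  refine ⟨N, fun n hn => ?_⟩
  obtain ⟨h1, h2, h3⟩ := hN n hn
  refine ⟨h1, h2, ?_⟩
  rw [Real.rpow_natCast, Real.norm_of_nonneg (by positivity), Real.norm_of_nonneg (by positivity),
    div_mul_eq_mul_div, one_mul, le_div_iff₀ (by positivity)] at h3
  have h4 : 1 ≤ (7 * Real.log n) ^ (2 * D) := one_le_pow₀ (by linarith)
  rw [mul_pow] at h4 ⊢
  linarith

theorem expected_error_bound {t : ℝ} (ht : 0 < t) (ht1 : t < 1) {d : ℕ → ℕ} {R : ℕ → ℝ}
    {D : ℕ} (hd : ∀ n, d n ≤ D) {R' : ℝ} (hR' : ∀ n, R n ≤ R') (hR : ∀ n, 0 < R n) :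
    ∃ C : ℝ, 0 < C ∧
      ∀ (n r : ℕ), 1 ≤ n → |(r : ℝ) - (n : ℝ) ^ (t / 2)| < 1 →
      ∀ (β : ℝ), 0 < β →
      ∀ (Q K V : Matrix (Fin n) (Fin (d n)) ℝ),
        β * rowNorm Q * rowNorm (recentre K) ≤ R n →
        (wildCat β r Q K V).expect (fun O' => maxNorm (softmaxAttention β Q K V - O')) ≤
          ENNReal.ofReal (C * (Real.log n /
            (n : ℝ) ^ (0.14 * t * (1 + Real.log (1 + Real.log n / (kappa * R n))))) *
              maxNorm V) := by
  set E : ℕ → ℝ := fun n =>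
    (n : ℝ) ^ (0.14 * t * (1 + Real.log (1 + Real.log n / (kappa * R n)))) with hE
  have hE0 : ∀ n, 0 ≤ E n := fun n => by positivity
  have hℓ0 : ∀ n : ℕ, 0 ≤ Real.log n := fun n => Real.log_natCast_nonneg n
  obtain ⟨N, hN⟩ := eventually_large ht D (max (R' * rho0 * Real.exp (1 / 2)) (kappa * R'))
  set C₁ := 4 * (Real.exp R' * Real.exp R' * Real.sqrt (3 * (D + 1) * Real.exp R')) with hC₁
  have hC₁0 : 0 < C₁ := by
    have : 0 < Real.sqrt (3 * (D + 1) * Real.exp R') := Real.sqrt_pos.2 (by positivity)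
    positivity
  -- Covers 2 ≤ n < N through the trivial bound 2‖V‖. The terms m = 0, 1 are 0 through division by
  -- log m = 0.
  set C₂ := ∑ m ∈ Finset.range N, 2 * E m / Real.log m with hC₂
  have hterm : ∀ m : ℕ, 0 ≤ 2 * E m / Real.log m := fun m =>
    div_nonneg (mul_nonneg zero_le_two (hE0 m)) (hℓ0 m)
  have hC₂0 : 0 ≤ C₂ := Finset.sum_nonneg fun m _ => hterm m
  refine ⟨C₁ + C₂, by positivity, fun n r hn hr β hβ Q K V hρ => ?_⟩
  have hV := maxNorm_nonneg V
  have hratio : 0 ≤ Real.log n / E n := div_nonneg (hℓ0 n) (hE0 n)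
  by_cases hnN : N ≤ n
  · obtain ⟨h1, h2, h3⟩ := hN n hnN
    refine (expect_wildCat_le_of_large ht ht1 (hd n) (hR n) (hR' n) h1
      ((le_max_left _ _).trans h2) ((le_max_right _ _).trans h2) h3 hr hβ Q K V hρ).trans
      (ENNReal.ofReal_le_ofReal ?_)
    gcongr
    exact le_add_of_nonneg_right hC₂0
  · rcases hn.eq_or_lt with rfl | hn2
    · rw [expect_wildCat_of_one]
      exact zero_le
    · refine (expect_wildCat_le_two_mul hn β Q K V).trans (ENNReal.ofReal_le_ofReal ?_)
      refine mul_le_mul_of_nonneg_right ?_ hV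
      have hℓ : 0 < Real.log n := Real.log_pos (by exact_mod_cast hn2)
      have hEn : 0 < E n := Real.rpow_pos_of_pos (by exact_mod_cast hn) _
      calc (2 : ℝ) = 2 * E n / Real.log n * (Real.log n / E n) := by field_simp
        _ ≤ (C₁ + C₂) * (Real.log n / E n) := by
            gcongr
            have := Finset.single_le_sum (f := fun m : ℕ => 2 * E m / Real.log m)
              (fun m _ => hterm m) (Finset.mem_range.2 (not_le.1 hnN))
            exact this.trans (le_add_of_nonneg_left hC₁0.le)

/-! ## Operation counts -/

theorem cost_bind_le {α β : Type} {x : Timed α} {f : α → Timed β} {a b : ℕ} (hx : x.cost ≤ a)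
    (hf : ∀ v, (f v).cost ≤ b) : (x >>= f).cost ≤ a + b :=
  add_le_add hx (hf _)

theorem tabT_cost_le {k : ℕ} {f : Fin k → Timed ℝ} {c : ℕ} (h : ∀ i, (f i).cost ≤ c) :
    (tabT f).cost ≤ k * (c + 1) := by
  have : ∑ i, (f i).cost ≤ k * c := by
    simpa using Finset.sum_le_card_nsmul Finset.univ (fun i => (f i).cost) c fun i _ => h i
  rw [mul_add, mul_one]
  exact Nat.add_le_add_right this k

theorem sumT_cost_le {k : ℕ} {f : Fin k → Timed ℝ} {c : ℕ} (h : ∀ i, (f i).cost ≤ c) :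
    (sumT f).cost ≤ k * (c + 1) :=
  tabT_cost_le h

theorem supT_cost_le {k : ℕ} {f : Fin k → Timed ℝ} {c : ℕ} (h : ∀ i, (f i).cost ≤ c) :
    (supT f).cost ≤ k * (c + 1) :=
  tabT_cost_le h

theorem infT_cost_le {k : ℕ} {f : Fin k → Timed ℝ} {c : ℕ} (h : ∀ i, (f i).cost ≤ c) :
    (infT f).cost ≤ k * (c + 1) :=
  tabT_cost_le h

theorem tabMatT_cost_le {m k : ℕ} {f : Fin m → Fin k → Timed ℝ} {c : ℕ}
    (h : ∀ i j, (f i j).cost ≤ c) : (tabMatT f).cost ≤ m * k * (c + 1) := by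
  have h1 : ∀ i, ∑ j, (f i j).cost ≤ k * c := fun i => by
    simpa using Finset.sum_le_card_nsmul Finset.univ (fun j => (f i j).cost) c fun j _ => h i j
  have h2 : ∑ i, ∑ j, (f i j).cost ≤ m * (k * c) := by
    simpa using Finset.sum_le_card_nsmul Finset.univ (fun i => ∑ j, (f i j).cost) (k * c)
      fun i _ => h1 i
  rw [mul_add, mul_one, mul_assoc]
  exact Nat.add_le_add_right h2 (m * k)

theorem dotT_cost_le {k : ℕ} (x y : Fin k → ℝ) : (dotT x y).cost ≤ k * 2 :=
  sumT_cost_le fun _ => le_rfl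

theorem rowNormT_cost_le {m k : ℕ} (A : Matrix (Fin m) (Fin k) ℝ) :
    (rowNormT A).cost ≤ m * (k * 2 + 1 + 1) :=
  supT_cost_le fun _ => cost_bind_le (dotT_cost_le _ _) fun _ => le_rfl

theorem kernelT_cost_le {d : ℕ} (β τ : ℝ) (x y : Fin d → ℝ) :
    (kernelT β τ x y).cost ≤ d * 2 + 4 :=
  cost_bind_le (dotT_cost_le _ _) fun _ => le_rfl

theorem nysUpdate_cost_le {n d r : ℕ} {h : (Fin d → ℝ) → (Fin d → ℝ) → Timed ℝ} {c : ℕ}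
    (hc : ∀ x y, (h x y).cost ≤ c) (K : Matrix (Fin n) (Fin d) ℝ) (i : ℕ) (s : Fin n)
    (st : NysState n d r) :
    (nysUpdate h K i s st).cost ≤ d * (0 + 1) + (1 + (r * (r * 2 + 1 + 1) + (r * r * (2 + 1) +
      (n * (c + 1) + (n * (r * 2 + 1) + (n * (2 + 1) + 0)))))) := by
  refine cost_bind_le (tabT_cost_le fun _ => le_rfl) fun ks => ?_
  refine cost_bind_le le_rfl fun root => ?_
  refine cost_bind_le (tabT_cost_le fun a => ?_) fun g => ?_
  · split_ifs
    · exact cost_bind_le (dotT_cost_le _ _) fun _ => le_rfl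
    · exact Nat.le_add_left 1 _
    · exact Nat.zero_le _
  refine cost_bind_le (tabMatT_cost_le fun a b => le_rfl) fun M => ?_
  refine cost_bind_le (tabT_cost_le fun l => hc _ _) fun row => ?_
  refine cost_bind_le (tabT_cost_le fun l => dotT_cost_le _ _) fun δ => ?_
  refine cost_bind_le (tabT_cost_le fun l => ?_) fun p => le_rfl
  split_ifs
  · exact Nat.zero_le _
  · exact le_rfl

/-- Every run takes at most `c` operations. -/
def RandT.CostLE {α : Type} (x : RandT α) (c : ℕ) : Prop := ∀ ω ∈ x.outcomes, ω.cost ≤ c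

theorem RandT.CostLE.bind {α β : Type} {x : RandT α} {f : α → RandT β} {a b : ℕ}
    (hx : x.CostLE a) (hf : ∀ v, (f v).CostLE b) : (x >>= f).CostLE (a + b) := by
  intro ω hω
  obtain ⟨y, hy, z, hz, rfl⟩ := RandT.mem_outcomes_bind.1 hω
  exact add_le_add (hx y hy) (hf _ z hz)

theorem RandT.CostLE.lift {α : Type} {x : Timed α} {c : ℕ} (hx : x.cost ≤ c) :
    (RandT.lift x).CostLE c := by
  intro ω hω
  rw [RandT.mem_outcomes_lift.1 hω]
  exact hx

theorem RandT.CostLE.pure {α : Type} (x : α) (c : ℕ) : (Pure.pure x : RandT α).CostLE c :=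
  RandT.CostLE.lift (x := ⟨x, 0⟩) (Nat.zero_le c)

theorem nysLoop_costLE {n d r : ℕ} {h : (Fin d → ℝ) → (Fin d → ℝ) → Timed ℝ} {c : ℕ}
    (hc : ∀ x y, (h x y).cost ≤ c) (K : Matrix (Fin n) (Fin d) ℝ) (st : NysState n d r) (k : ℕ) :
    (nysLoop h K st k).CostLE (k * ((3 * n + 2) + (d * (0 + 1) + (1 + (r * (r * 2 + 1 + 1) +
      (r * r * (2 + 1) + (n * (c + 1) + (n * (r * 2 + 1) + (n * (2 + 1) + 0))))))))) := by
  induction k with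
  | zero => exact RandT.CostLE.pure _ _
  | succ k ih =>
    rw [Nat.add_mul, one_mul]
    refine RandT.CostLE.bind ih fun st' => ?_
    refine RandT.CostLE.bind (fun ω hω => (outcomes_samplePivot hω).1) fun o => ?_
    cases o with
    | none => exact RandT.CostLE.pure _ _
    | some s => exact RandT.CostLE.lift (nysUpdate_cost_le hc K k s st')

/-- Costs add along the binds. Updating `M` over all rounds costs of order r³, the one place where r
≤ 2n is needed; the rest folds into n r² and n d r. -/
theorem wildCat_costLE {n d r : ℕ} (hn : 1 ≤ n) (hr : 1 ≤ r) (hrn : r ≤ 2 * n) (β : ℝ)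
    (Q K V : Matrix (Fin n) (Fin d) ℝ) :
    (wildCat β r Q K V).CostLE (100 * (n * r ^ 2 + n * d * r)) := by
  have hrp : ∀ (τ : ℝ) (K : Matrix (Fin n) (Fin d) ℝ), (rpNys (kernelT β τ) r K).CostLE _ :=
    fun τ K =>
      RandT.CostLE.bind (.lift (tabT_cost_le fun l => kernelT_cost_le β τ _ _)) fun p =>
      RandT.CostLE.bind (.lift (tabMatT_cost_le fun _ _ => le_refl 0)) fun KS =>
      RandT.CostLE.bind (.lift (tabMatT_cost_le fun _ _ => le_refl 0)) fun M =>
      RandT.CostLE.bind (.lift (tabMatT_cost_le fun _ _ => le_refl 0)) fun R =>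
      RandT.CostLE.bind (nysLoop_costLE (kernelT_cost_le β τ) K _ r) fun st =>
      RandT.CostLE.bind (.lift (tabMatT_cost_le fun a l => dotT_cost_le _ _)) fun W =>
      RandT.CostLE.pure _ 0
  have hcomp : ∀ RQ : ℝ, (compressKV β RQ r K V).CostLE _ := fun RQ =>
    RandT.CostLE.bind (.lift (tabT_cost_le fun j =>
      cost_bind_le (sumT_cost_le fun l => le_refl 0) fun _ => le_refl 1)) fun mean =>
    RandT.CostLE.bind (.lift (tabMatT_cost_le fun l j => le_refl 1)) fun Kc =>
    RandT.CostLE.bind (.lift (rowNormT_cost_le _)) fun RK =>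
    RandT.CostLE.bind (.lift (le_refl 13)) fun τ =>
    RandT.CostLE.bind (hrp _ _) fun c =>
    RandT.CostLE.bind (.lift (tabMatT_cost_le fun a j => le_refl 1)) fun KS =>
    RandT.CostLE.bind (.lift (tabMatT_cost_le fun a j => dotT_cost_le _ _)) fun VS =>
    RandT.CostLE.bind (.lift (tabT_cost_le fun a => sumT_cost_le fun l => le_refl 0)) fun w =>
    RandT.CostLE.pure _ 0
  have hattn : ∀ (KS VS : Matrix (Fin r) (Fin d) ℝ) (w : Fin r → ℝ) (vmin vmax : Fin d → ℝ),
      (wtdAttn β Q KS VS w vmin vmax).cost ≤ _ := fun KS VS w vmin vmax =>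
    cost_bind_le (tabMatT_cost_le fun i a =>
      cost_bind_le (dotT_cost_le _ _) fun _ => le_refl 2) fun A =>
    cost_bind_le (tabT_cost_le fun i => dotT_cost_le _ _) fun D =>
    tabMatT_cost_le fun i j => cost_bind_le (dotT_cost_le _ _) fun _ => le_refl 4
  have htotal : (wildCat β r Q K V).CostLE _ :=
    RandT.CostLE.bind (.lift (tabT_cost_le fun j => infT_cost_le fun l => le_refl 0)) fun vmin =>
    RandT.CostLE.bind (.lift (tabT_cost_le fun j => supT_cost_le fun l => le_refl 0)) fun vmax =>
    RandT.CostLE.bind (.lift (rowNormT_cost_le Q)) fun RQ =>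
    RandT.CostLE.bind (hcomp RQ) fun c =>
    RandT.CostLE.lift (hattn _ _ _ _ _)
  refine fun ω hω => (htotal ω hω).trans ?_
  have hr2 : r ≤ r ^ 2 := Nat.le_self_pow two_ne_zero r
  have hX : r ^ 2 ≤ n * r ^ 2 := Nat.le_mul_of_pos_left _ hn
  have hX1 : 1 ≤ n * r ^ 2 := hr.trans (hr2.trans hX)
  have hXn : n ≤ n * r ^ 2 := Nat.le_mul_of_pos_right _ (by positivity)
  have hXrn : n * r ≤ n * r ^ 2 := Nat.mul_le_mul_left n hr2
  have hX3 : r * r ^ 2 ≤ 2 * n * r ^ 2 := Nat.mul_le_mul_right _ hrn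
  have hYnd : n * d ≤ n * d * r := Nat.le_mul_of_pos_right _ hr
  have hYd : d ≤ n * d := Nat.le_mul_of_pos_left _ hn
  have hYrd : d * r ≤ n * (d * r) := Nat.le_mul_of_pos_left _ hn
  nlinarith

theorem runtime_bound {t : ℝ} (ht : 0 < t) (ht1 : t < 1) {n d r : ℕ} (hn : 1 ≤ n)
    (hr : |(r : ℝ) - (n : ℝ) ^ (t / 2)| < 1) (β : ℝ) (Q K V : Matrix (Fin n) (Fin d) ℝ)
    {out : Timed (Matrix (Fin n) (Fin d) ℝ)} (hout : out ∈ (wildCat β r Q K V).outcomes) :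
    (out.cost : ℝ) ≤ 400 * ((n : ℝ) ^ (1 + t) + (d : ℝ) * (n : ℝ) ^ (1 + t / 2)) := by
  obtain ⟨hr1, hr2⟩ := abs_lt.1 hr
  have hn1 : (1 : ℝ) ≤ n := by exact_mod_cast hn
  have hn0 : (0 : ℝ) < n := by linarith
  set a := (n : ℝ) ^ (t / 2) with ha
  have ha1 : 1 ≤ a := Real.one_le_rpow hn1 (by linarith)
  have han : a ≤ n := by
    calc a ≤ (n : ℝ) ^ (1 : ℝ) := Real.rpow_le_rpow_of_exponent_le hn1 (by linarith)
      _ = n := Real.rpow_one _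
  -- From r < a + 1 and a ≥ 1; squaring gives the factor 4 that turns 100 into 400.
  have hra : (r : ℝ) ≤ 2 * a := by linarith
  have hrpos : 1 ≤ r := by
    have : (0 : ℝ) < r := by linarith
    exact_mod_cast this
  have hrn : r ≤ 2 * n := by
    have : (r : ℝ) ≤ 2 * n := by linarith
    exact_mod_cast this
  have hcost : (out.cost : ℝ) ≤ 100 * (n * r ^ 2 + n * d * r) := by
    exact_mod_cast wildCat_costLE hn hrpos hrn β Q K V out hout
  have h1 : (n : ℝ) ^ (1 + t) = n * a ^ 2 := by
    rw [Real.rpow_add hn0, Real.rpow_one, ha, ← Real.rpow_natCast, ← Real.rpow_mul hn0.le]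
    congr 2
    push_cast
    ring
  have h2 : (n : ℝ) ^ (1 + t / 2) = n * a := by
    rw [Real.rpow_add hn0, Real.rpow_one]
  rw [h1, h2]
  have h3 : (n : ℝ) * r ^ 2 ≤ n * (2 * a) ^ 2 := by gcongr
  have h4 : (n : ℝ) * d * r ≤ n * d * (2 * a) := by gcongr
  have h5 : (0 : ℝ) ≤ n * d * a := by positivity
  nlinarith

end WildCat

theorem mainTheorem5 :
    -- runtime: every run takes `O(n^{1+t} + d n^{1+t/2})` elementary operations
    (∃ C₀ : ℝ, 0 < C₀ ∧
      ∀ (t : ℝ), 0 < t → t < 1 →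
      ∀ (n d r : ℕ), 1 ≤ n → |(r : ℝ) - (n : ℝ) ^ (t / 2)| < 1 →
      ∀ (β : ℝ), 0 < β →
      ∀ (Q K V : Matrix (Fin n) (Fin d) ℝ),
      ∀ out ∈ (WildCat.wildCat β r Q K V).outcomes,
        (out.cost : ℝ) ≤ C₀ * ((n : ℝ) ^ (1 + t) + (d : ℝ) * (n : ℝ) ^ (1 + t / 2))) ∧
    -- expected error
    (∀ (t : ℝ), 0 < t → t < 1 →
      ∀ (d : ℕ → ℕ) (R : ℕ → ℝ),
      (∃ D : ℕ, ∀ n, d n ≤ D) → (∃ R' : ℝ, ∀ n, R n ≤ R') → (∀ n, 0 < R n) →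
      ∃ C : ℝ, 0 < C ∧
        ∀ (n r : ℕ), 1 ≤ n → |(r : ℝ) - (n : ℝ) ^ (t / 2)| < 1 →
        ∀ (β : ℝ), 0 < β →
        ∀ (Q K V : Matrix (Fin n) (Fin (d n)) ℝ),
          β * WildCat.rowNorm Q * WildCat.rowNorm (WildCat.recentre K) ≤ R n →
          (WildCat.wildCat β r Q K V).expect
              (fun O' => WildCat.maxNorm (WildCat.softmaxAttention β Q K V - O')) ≤
            ENNReal.ofReal
              (C * (Real.log n /
                  (n : ℝ) ^ (0.14 * t * (1 + Real.log (1 + Real.log n / (WildCat.kappa * R n))))) *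
                WildCat.maxNorm V)) := by
  refine ⟨⟨400, by norm_num, fun t ht ht1 n d r hn hr β _ Q K V out hout =>
    WildCat.runtime_bound ht ht1 hn hr β Q K V hout⟩, fun t ht ht1 d R hd hR hpos => ?_⟩
  obtain ⟨D, hD⟩ := hd
  obtain ⟨R', hR'⟩ := hR
  exact WildCat.expected_error_bound ht ht1 hD hR' hpos
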